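/- Let $\mathbb{K}\in\{\mathbb{R},\mathbb{C}\}$, $1\le p<\infty$, $N\ge 2$, $[N]=\{1,\dots,N\}$, and let $w_s=(w_{s,n})_{n\ge1}$, $s\in[N]$, be bounded sequences in $\mathbb{K}$. Let $B_{w_s}$ be the unilateral weighted backward shift on $\ell^p(\mathbb{N})$ (over $\mathbb{K}$, with canonical basis $(e_n)_{n\ge1}$), that is, $B_{w_s}e_1=0$ and $B_{w_s}e_n=w_{s,n}e_{n-1}$ for $n\ge2$. For $l\ge1$ and $n\ge 0$ put $W^s_{l,n}=\prod_{\nu=1}^n w_{s,l+\nu}$. Let $\mathcal{A}$ be one of the families $\mathcal{A}_{uBd}$, $\mathcal{A}_{ud}$, $\mathcal{A}_{ld}$ of all sets $A$ of natural numbers with, respectively, positive upper Banach density $\limsup_{M\to\infty}\sup_{k\ge 0}\frac{|A\cap[k+1,k+M]|}{M}$, positive upper density $\limsup_{M\to\infty}\frac{|A\cap[1,M]|}{M}$, positive lower density $\liminf_{M\to\infty}\frac{|A\cap[1,M]|}{M}$. Operators $T_1,\dots,T_N$ on $X$ are called disjoint $\mathcal{A}$-hypercyclic if there is $x\in X$ such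 that $\{n\ge 0:(T_1^nx,\dots,T_N^nx)\in U\}\in\mathcal{A}$ for every non-empty open set $U\subset X^N$. Then $B_{w_1},\dots,B_{w_N}$ are disjoint $\mathcal{A}$-hypercyclic on $\ell^p(\mathbb{N})$ if and only if there exist pairwise disjoint sets $A_k\in\mathcal{A}$, $k\ge1$, and a sequence $(\varepsilon_k)_{k\ge1}$ of positive real numbers tending to $0$ such that (with the convention $1/0=+\infty$, so that (1) forces $w_{s,n}\neq 0$ for all $n\ge2$) (1) for every $s\in[N]$, $\displaystyle\sum_{n\ge1}\frac{1}{|W^s_{1,n}|^p}<\infty$; (2) for all $1\le j\le l$, all $k\ge1$, all $n\in A_k$ and all $s\ne t$ in $[N]$, $$\sum_{m\in A_l,\;m>n}\frac{|W^s_{j+m-n,n}|^p}{|W^t_{j,m}|^p}\le\varepsilon_l;$$ (3) for all $1\le j\le k<l$, all $n\in A_l$ and all $s\ne t$ in $[N]$, $$\sum_{m\in A_k,\;m>n}\frac{|W^s_{j+m-n,n}|^p}{|W^t_{j,m}|^p}\le\varepsilon_l;$$ (4) for every $l\ge1$, every family $(a_{s,j})_{s\in[N],\,1\le j\le l}$ of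 nonzero elements of $\mathbb{K}$ and every $\varepsilon>0$, there exists $L\ge l$ such that for all $s\ne t$ in $[N]$, all $n\in A_L$ and all $1\le j\le l$, $$\left|\frac{W^s_{j,n}}{W^t_{j,n}}-\frac{a_{s,j}}{a_{t,j}}\right|<\varepsilon.$$ -/

import Mathlib

open Set Filter Topology
open scoped ENNReal

noncomputable section

/-- Lower density of a set of natural numbers. -/
def lowerDensity (A : Set ℕ) : ℝ :=
  liminf (fun N : ℕ => ((A ∩ Icc 1 N).ncard : ℝ) / N) atTop

/-- Upper density of a set of natural numbers. -/
def upperDensity (A : Set ℕ) : ℝ :=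
  limsup (fun N : ℕ => ((A ∩ Icc 1 N).ncard : ℝ) / N) atTop

/-- Upper Banach density of a set of natural numbers; the supremum is over values in `[0, 1]`. -/
def upperBanachDensity (A : Set ℕ) : ℝ :=
  limsup (fun N : ℕ => ⨆ k : ℕ, ((A ∩ Icc (k + 1) (k + N)).ncard : ℝ) / N) atTop

/-- The family of sets of positive upper Banach density. -/
def familyUBd : Set (Set ℕ) := {A | 0 < upperBanachDensity A}

/-- The family of sets of positive upper density. -/
def familyUd : Set (Set ℕ) := {A | 0 < upperDensity A}

/-- The family of sets of positive lower density. -/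
def familyLd : Set (Set ℕ) := {A | 0 < lowerDensity A}

/-- `x` is an `𝒜`-hypercyclic vector for `T`: the return times of the orbit of `x` to any non-empty
open set form a member of `𝒜`. -/
def IsHypercyclicVector {𝕜 X : Type*} [NontriviallyNormedField 𝕜] [AddCommGroup X] [Module 𝕜 X]
    [TopologicalSpace X] (𝒜 : Set (Set ℕ)) (T : X →L[𝕜] X) (x : X) : Prop :=
  ∀ U : Set X, IsOpen U → U.Nonempty → {n : ℕ | (T ^ n) x ∈ U} ∈ 𝒜

/-- `T₁, …, T_N` are disjoint `𝒜`-hypercyclic: for some `x`, the diagonal vector `(x, …, x)` is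
`𝒜`-hypercyclic for the direct sum `T₁ ⊕ ⋯ ⊕ T_N` on `X ^ N`. -/
def DisjointHypercyclic {𝕜 X : Type*} [NontriviallyNormedField 𝕜] [AddCommGroup X] [Module 𝕜 X]
    [TopologicalSpace X] {N : ℕ} (𝒜 : Set (Set ℕ)) (T : Fin N → X →L[𝕜] X) : Prop :=
  ∃ x : X, IsHypercyclicVector 𝒜 (ContinuousLinearMap.piMap T) (fun _ => x)

section WeightedShift

set_option linter.unusedSectionVars false

variable {𝕜 : Type*} [RCLike 𝕜] (p : ℝ≥0∞) [Fact (1 ≤ p)] (w : ℕ+ → 𝕜)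

/-- An upper bound for the moduli of a bounded weight sequence. -/
theorem norm_weight_le (hw : BddAbove (range fun n => ‖w n‖)) (n : ℕ+) :
    ‖w n‖ ≤ ⨆ m, ‖w m‖ := le_ciSup hw n

theorem iSup_norm_weight_nonneg : 0 ≤ ⨆ m, ‖w m‖ := Real.iSup_nonneg fun _ => norm_nonneg _

theorem sum_shift_le (hw : BddAbove (range fun n => ‖w n‖)) (h0 : 0 < p.toReal)
    (x : lp (fun _ : ℕ+ => 𝕜) p) (s : Finset ℕ+) :
    ∑ n ∈ s, ‖w (n + 1) * x (n + 1)‖ ^ p.toReal ≤ ((⨆ m, ‖w m‖) * ‖x‖) ^ p.toReal := by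
  have hC := iSup_norm_weight_nonneg w
  calc ∑ n ∈ s, ‖w (n + 1) * x (n + 1)‖ ^ p.toReal
      ≤ ∑ n ∈ s, (⨆ m, ‖w m‖) ^ p.toReal * ‖x (n + 1)‖ ^ p.toReal := by
        refine Finset.sum_le_sum fun n _ => ?_
        rw [← Real.mul_rpow hC (norm_nonneg _), norm_mul]
        exact Real.rpow_le_rpow (by positivity)
          (mul_le_mul_of_nonneg_right (norm_weight_le w hw _) (norm_nonneg _)) h0.le
    _ = (⨆ m, ‖w m‖) ^ p.toReal *
          ∑ n ∈ s.map (addRightEmbedding 1), ‖x n‖ ^ p.toReal := by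
        rw [← Finset.mul_sum, Finset.sum_map]
        rfl
    _ ≤ (⨆ m, ‖w m‖) ^ p.toReal * ‖x‖ ^ p.toReal :=
        mul_le_mul_of_nonneg_left (lp.sum_rpow_le_norm_rpow h0 x _) (Real.rpow_nonneg hC _)
    _ = ((⨆ m, ‖w m‖) * ‖x‖) ^ p.toReal := (Real.mul_rpow hC (norm_nonneg _)).symm

theorem norm_shift_le (hw : BddAbove (range fun n => ‖w n‖)) (hp : p = ∞)
    (x : lp (fun _ : ℕ+ => 𝕜) p) (n : ℕ+) :
    ‖w (n + 1) * x (n + 1)‖ ≤ (⨆ m, ‖w m‖) * ‖x‖ := by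
  rw [norm_mul]
  exact mul_le_mul (norm_weight_le w hw _) (lp.norm_apply_le_norm (by simp [hp]) x _)
    (norm_nonneg _) (iSup_norm_weight_nonneg w)

theorem toReal_pos_of_ne_top (hp : p ≠ ∞) : 0 < p.toReal :=
  ENNReal.toReal_pos (zero_lt_one.trans_le (Fact.out : 1 ≤ p)).ne' hp

theorem memℓp_shift (hw : BddAbove (range fun n => ‖w n‖)) (x : lp (fun _ : ℕ+ => 𝕜) p) :
    Memℓp (fun n : ℕ+ => w (n + 1) * x (n + 1)) p := by
  by_cases hp : p = ∞
  · have h := norm_shift_le p w hw hp x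
    subst hp
    exact memℓp_infty ⟨_, by rintro _ ⟨n, rfl⟩; exact h n⟩
  · exact memℓp_gen' (sum_shift_le p w hw (toReal_pos_of_ne_top p hp) x)

/-- The unilateral weighted backward shift `B_w` on `ℓ^p(ℕ)`, where `ℕ = {1, 2, …}` indexes the
canonical basis: `B_w e₁ = 0` and `B_w eₙ = wₙ eₙ₋₁` for `n ≥ 2`, that is,
`(B_w x)ₙ = wₙ₊₁ xₙ₊₁` for all `n ≥ 1`. -/
def weightedShift (hw : BddAbove (range fun n => ‖w n‖)) :
    lp (fun _ : ℕ+ => 𝕜) p →L[𝕜] lp (fun _ : ℕ+ => 𝕜) p :=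
  LinearMap.mkContinuous
    { toFun := fun x => ⟨fun n => w (n + 1) * x (n + 1), memℓp_shift p w hw x⟩
      map_add' := fun x y => by
        ext n
        exact mul_add _ _ _
      map_smul' := fun c x => by
        ext n
        exact mul_left_comm _ _ _ }
    (⨆ m, ‖w m‖)
    (fun x => by
      have hC : 0 ≤ (⨆ m, ‖w m‖) * ‖x‖ :=
        mul_nonneg (iSup_norm_weight_nonneg w) (norm_nonneg _)
      by_cases hp : p = ∞
      · have h := norm_shift_le p w hw hp x
        subst hp
        exact lp.norm_le_of_forall_le hC h
      · have h0 := toReal_pos_of_ne_top p hp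
        exact lp.norm_le_of_forall_sum_le h0 hC (sum_shift_le p w hw h0 x))

end WeightedShift

/-- The product of weights `W_{l,n} = w_{l+1} w_{l+2} ⋯ w_{l+n}`. -/
def weightProd {𝕜 : Type*} [RCLike 𝕜] (w : ℕ+ → 𝕜) (l n : ℕ) : 𝕜 :=
  ∏ ν ∈ Finset.range n, w (Nat.succPNat (l + ν))

end

/-! Everything rests on one formula: the `j`-th coordinate of `B_{w_s}^n x` is `W^s_{j,n} x_{j+n}`.
If `x_{j+n} ≠ 0`, the quotient of the `j`-th coordinates of two orbits at time `n` is therefore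
`W^s_{j,n} / W^t_{j,n}`, whatever `x` is; this is the origin of (4).

Necessity. Choose targets `y_k` supported on the first `k + 1` coordinates, with recurrently dense
coordinate ratios and norms growing very fast, and let `A_k` be the times at which the orbits are
close to `y_k` (`exists_targets`, `exists_sets_of_isHypercyclicVector`). The growth makes the `A_k`
disjoint. It also forces a return `m` to an earlier or equal target to come more than `k` steps
after a time `n ∈ A_k`, so that the entries of `x` seen at time `m` lie, at time `n`, beyond the
support of `y_k`. Their total size is at most the approximation error, which bounds the sums in (2)
and (3); when `m` returns to a later target, the bound comes from the size of that target. Condition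
(1) is of another nature: the returns near `2 e_1` bound the sum of `|W_{1,i}|^{-p}` over
differences `i` of a set of positive upper Banach density, and the Bayart–Ruzsa argument
(`tsum_ne_top_of_tsum_differences_le`) extends this to all `i`.

Sufficiency. Fix one shift `s₀`. Pass to levels where (4) realises the ratios of a prescribed array
and thin the corresponding sets to widely separated subsets `B_l` (`exists_separated_family`). At
each `m ∈ B_l` put into `x` the block which the `s₀`-shift carries exactly onto the array; by (4)
the other shifts carry it nearly onto their arrays. The other blocks disturb little: for `s₀` by (1)
and the gaps, for the other shifts by (2) and (3). This is `exists_sequence_visiting`; density of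
the arrays gives hypercyclicity. -/

theorem exists_dependent_seq {α : Type*} (P : ℕ → α → Prop) (r : ℕ → α → α → Prop)
    (h : ∀ (n : ℕ) (F : Finset α), ∃ y, P n y ∧ ∀ x ∈ F, r n x y) :
    ∃ f : ℕ → α, (∀ n, P n (f n)) ∧ ∀ m n, m < n → r n (f m) (f n) := by
  classical
  choose g hg hr using h
  -- `F n` collects the values chosen before stage `n`, so each new value is compared with all
  -- earlier ones.
  let F : ℕ → Finset α := fun n => Nat.rec ∅ (fun n s => insert (g n s) s) n
  have hF : ∀ n, F (n + 1) = insert (g n (F n)) (F n) := fun n => rfl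
  have hmem : ∀ m n, m < n → g m (F m) ∈ F n := by
    intro m n hmn
    induction n with
    | zero => omega
    | succ n ih =>
      rw [hF]
      rcases Nat.lt_succ_iff_lt_or_eq.1 hmn with h | rfl
      · exact Finset.mem_insert_of_mem (ih h)
      · exact Finset.mem_insert_self _ _
  exact ⟨fun n => g n (F n), fun n => hg _ _, fun m n hmn => hr _ _ _ (hmem m n hmn)⟩

/-! ### Densities -/

theorem ncard_inter_Icc_le (A : Set ℕ) (k M : ℕ) : (A ∩ Icc (k + 1) (k + M)).ncard ≤ M := by
  calc (A ∩ Icc (k + 1) (k + M)).ncard ≤ (Icc (k + 1) (k + M)).ncard :=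
        ncard_le_ncard inter_subset_right (finite_Icc _ _)
    _ = M := by
        rw [← Finset.coe_Icc, ncard_coe_finset, Nat.card_Icc]
        omega

theorem ncard_inter_Icc_div_le (A : Set ℕ) (k M : ℕ) :
    ((A ∩ Icc (k + 1) (k + M)).ncard : ℝ) / M ≤ 1 :=
  div_le_one_of_le₀ (by exact_mod_cast ncard_inter_Icc_le A k M) (Nat.cast_nonneg _)

theorem ncard_inter_Icc_one_div_le (A : Set ℕ) (M : ℕ) :
    ((A ∩ Icc 1 M).ncard : ℝ) / M ≤ 1 := by
  simpa using ncard_inter_Icc_div_le A 0 M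

/-- The bounds `0` and `1` keep the real `limsup` from taking a default value; half of a positive
`limsup` serves as `δ`. -/
theorem limsup_pos_iff_exists_frequently {u : ℕ → ℝ} (h0 : ∀ n, 0 ≤ u n) (h1 : ∀ n, u n ≤ 1) :
    0 < limsup u atTop ↔ ∃ δ > 0, ∃ᶠ n in atTop, δ ≤ u n := by
  have hb : IsBoundedUnder (· ≤ ·) atTop u := isBoundedUnder_of ⟨1, h1⟩
  have hc : IsCoboundedUnder (· ≤ ·) atTop u :=
    IsBoundedUnder.isCoboundedUnder_le (isBoundedUnder_of ⟨0, h0⟩)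
  constructor
  · intro h
    exact ⟨_, half_pos h, (frequently_lt_of_lt_limsup hc (half_lt_self h)).mono fun n hn => hn.le⟩
  · rintro ⟨δ, hδ, h⟩
    exact hδ.trans_le (le_limsup_of_frequently_le h hb)

theorem liminf_pos_iff_exists_eventually {u : ℕ → ℝ} (h0 : ∀ n, 0 ≤ u n) (h1 : ∀ n, u n ≤ 1) :
    0 < liminf u atTop ↔ ∃ δ > 0, ∀ᶠ n in atTop, δ ≤ u n := by
  have hb : IsBoundedUnder (· ≥ ·) atTop u := isBoundedUnder_of ⟨0, h0⟩
  have hc : IsCoboundedUnder (· ≥ ·) atTop u :=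
    IsBoundedUnder.isCoboundedUnder_ge (isBoundedUnder_of ⟨1, h1⟩)
  constructor
  · intro h
    exact ⟨_, half_pos h, (eventually_lt_of_lt_liminf (half_lt_self h) hb).mono fun n hn => hn.le⟩
  · rintro ⟨δ, hδ, h⟩
    exact hδ.trans_le (le_liminf_of_le hc h)

theorem mem_familyUd_iff {A : Set ℕ} :
    A ∈ familyUd ↔ ∃ δ : ℝ, 0 < δ ∧ ∃ᶠ M : ℕ in atTop, δ * M ≤ (A ∩ Icc 1 M).ncard := by
  refine (limsup_pos_iff_exists_frequently (fun n => by positivity)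
    (ncard_inter_Icc_one_div_le A)).trans (exists_congr fun δ => and_congr_right fun _ => ?_)
  exact frequently_congr ((eventually_gt_atTop 0).mono fun M hM =>
    le_div_iff₀ (Nat.cast_pos.2 hM))

theorem mem_familyLd_iff {A : Set ℕ} :
    A ∈ familyLd ↔ ∃ δ : ℝ, 0 < δ ∧ ∀ᶠ M : ℕ in atTop, δ * M ≤ (A ∩ Icc 1 M).ncard := by
  refine (liminf_pos_iff_exists_eventually (fun n => by positivity)
    (ncard_inter_Icc_one_div_le A)).trans (exists_congr fun δ => and_congr_right fun _ => ?_)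
  exact eventually_congr ((eventually_gt_atTop 0).mono fun M hM =>
    le_div_iff₀ (Nat.cast_pos.2 hM))

theorem mem_familyUBd_iff {A : Set ℕ} :
    A ∈ familyUBd ↔
      ∃ δ : ℝ, 0 < δ ∧ ∃ᶠ M : ℕ in atTop, ∃ k, δ * M ≤ (A ∩ Icc (k + 1) (k + M)).ncard := by
  have hbdd : ∀ M : ℕ, BddAbove (range fun k : ℕ => ((A ∩ Icc (k + 1) (k + M)).ncard : ℝ) / M) :=
    fun M => ⟨1, by rintro _ ⟨k, rfl⟩; exact ncard_inter_Icc_div_le A k M⟩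
  refine (limsup_pos_iff_exists_frequently (fun M => Real.iSup_nonneg fun k => by positivity)
    (fun M => ciSup_le fun k => ncard_inter_Icc_div_le A k M)).trans ?_
  constructor
  · rintro ⟨δ, hδ, h⟩
    refine ⟨δ / 2, half_pos hδ, (h.and_eventually (eventually_gt_atTop 0)).mono ?_⟩
    rintro M ⟨h1, hM⟩
    obtain ⟨k, hk⟩ := exists_lt_of_lt_ciSup ((half_lt_self hδ).trans_le h1)
    exact ⟨k, (le_div_iff₀ (Nat.cast_pos.2 hM)).1 hk.le⟩
  · rintro ⟨δ, hδ, h⟩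
    refine ⟨δ, hδ, (h.and_eventually (eventually_gt_atTop 0)).mono ?_⟩
    rintro M ⟨⟨k, hk⟩, hM⟩
    exact ((le_div_iff₀ (Nat.cast_pos.2 hM)).2 hk).trans (le_ciSup (hbdd M) k)

theorem familyLd_subset_familyUd : familyLd ⊆ familyUd := fun A hA => by
  obtain ⟨δ, hδ, h⟩ := mem_familyLd_iff.1 hA
  exact mem_familyUd_iff.2 ⟨δ, hδ, h.frequently⟩

theorem familyUd_subset_familyUBd : familyUd ⊆ familyUBd := fun A hA => by
  obtain ⟨δ, hδ, h⟩ := mem_familyUd_iff.1 hA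
  exact mem_familyUBd_iff.2 ⟨δ, hδ, h.mono fun M hM => ⟨0, by simpa using hM⟩⟩

theorem ncard_inter_Icc_mono {A B : Set ℕ} (h : A ⊆ B) (a b : ℕ) :
    ((A ∩ Icc a b).ncard : ℝ) ≤ (B ∩ Icc a b).ncard := by
  exact_mod_cast ncard_le_ncard (inter_subset_inter_left _ h) ((finite_Icc a b).inter_of_right _)

theorem family_mono {𝒜 : Set (Set ℕ)} (h𝒜 : 𝒜 = familyUBd ∨ 𝒜 = familyUd ∨ 𝒜 = familyLd)
    {A B : Set ℕ} (hA : A ∈ 𝒜) (h : A ⊆ B) : B ∈ 𝒜 := by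
  rcases h𝒜 with rfl | rfl | rfl
  · obtain ⟨δ, hδ, hf⟩ := mem_familyUBd_iff.1 hA
    exact mem_familyUBd_iff.2 ⟨δ, hδ, hf.mono fun M ⟨k, hk⟩ =>
      ⟨k, hk.trans (ncard_inter_Icc_mono h _ _)⟩⟩
  · obtain ⟨δ, hδ, hf⟩ := mem_familyUd_iff.1 hA
    exact mem_familyUd_iff.2 ⟨δ, hδ, hf.mono fun M hk => hk.trans (ncard_inter_Icc_mono h _ _)⟩
  · obtain ⟨δ, hδ, hf⟩ := mem_familyLd_iff.1 hA
    exact mem_familyLd_iff.2 ⟨δ, hδ, hf.mono fun M hk => hk.trans (ncard_inter_Icc_mono h _ _)⟩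

theorem family_subset_familyUBd {𝒜 : Set (Set ℕ)}
    (h𝒜 : 𝒜 = familyUBd ∨ 𝒜 = familyUd ∨ 𝒜 = familyLd) : 𝒜 ⊆ familyUBd := by
  rcases h𝒜 with rfl | rfl | rfl
  · exact subset_rfl
  · exact familyUd_subset_familyUBd
  · exact familyLd_subset_familyUd.trans familyUd_subset_familyUBd

theorem exists_gt_mem_of_mem_familyUBd {A : Set ℕ} (hA : A ∈ familyUBd) (X : ℕ) :
    ∃ n ∈ A, X < n := by
  obtain ⟨δ, hδ, hf⟩ := mem_familyUBd_iff.1 hA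
  by_contra! h
  obtain ⟨M, ⟨k, hk⟩, hM⟩ := (hf.and_eventually
    (tendsto_natCast_atTop_atTop.eventually (eventually_gt_atTop ((X + 1 : ℝ) / δ)))).exists
  have h1 : (A ∩ Icc (k + 1) (k + M)).ncard ≤ X := by
    calc (A ∩ Icc (k + 1) (k + M)).ncard ≤ (Icc 1 X).ncard :=
          ncard_le_ncard (fun n hn => ⟨by have := hn.2.1; omega, h n hn.1⟩) (finite_Icc _ _)
      _ = X := by rw [← Finset.coe_Icc, ncard_coe_finset, Nat.card_Icc]; omega
  have h2 : ((A ∩ Icc (k + 1) (k + M)).ncard : ℝ) ≤ X := by exact_mod_cast h1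
  rw [div_lt_iff₀ hδ] at hM
  nlinarith

/-! ### Difference sets of sets of positive upper Banach density -/

/-- The return count of the shift by `r` to `S`. -/
noncomputable def shiftCount (E : Set ℕ) (S : Finset ℕ) (r : ℕ) : ℕ :=
  open Classical in (S.filter fun n => n + r ∈ E).card

open Classical in
/-- If the differences avoided by `D` are thick, then many almost disjoint translates exist. -/
theorem exists_translates {E : Set ℕ} {δ η : ℝ} (U : Filter ℕ) (S : ℕ → Finset ℕ)
    (hSE : ∀ M, ∀ n ∈ S M, n ∈ E) (hS : ∀ᶠ M : ℕ in U, δ * M ≤ (S M).card) (hη : 0 ≤ η)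
    (hgap : ∀ g : ℕ, ∃ a, ∀ r, a ≤ r → r ≤ a + g → ∀ᶠ M : ℕ in U, (shiftCount E (S M) r : ℝ) ≤ η * M)
    (q : ℕ) :
    ∃ F : Finset ℕ, F.card ≤ q ∧
      ∀ᶠ M : ℕ in U, (q * δ - q ^ 2 * η) * M ≤ (Finset.image₂ (· + ·) (S M) F).card := by
  induction q with
  | zero => exact ⟨∅, by simp, by simp⟩
  | succ q ih =>
    obtain ⟨F, hF, h⟩ := ih
    obtain ⟨a, ha⟩ := hgap (F.sup id)
    have hle : ∀ f ∈ F, f ≤ F.sup id := fun f hf => Finset.le_sup (f := id) hf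
    have hev : ∀ᶠ M : ℕ in U, ∀ f ∈ F,
        (shiftCount E (S M) (a + F.sup id - f) : ℝ) ≤ η * M :=
      (Finset.eventually_all F).2 fun f hf =>
        ha _ (by have := hle f hf; omega) (by omega)
    -- The new translate is placed so that its differences to all old ones fall in a single gap;
    -- each old translate then overlaps it in at most `η M` points.
    refine ⟨insert (a + F.sup id) F, (Finset.card_insert_le _ _).trans (by omega), ?_⟩
    filter_upwards [h, hev, hS] with M h1 h2 h3
    set r := a + F.sup id with hr
    have himg : Finset.image₂ (· + ·) (S M) (insert r F)
        = Finset.image₂ (· + ·) (S M) F ∪ (S M).image (· + r) := by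
      ext n
      simp only [Finset.mem_image₂, Finset.mem_insert, Finset.mem_union, Finset.mem_image]
      constructor
      · rintro ⟨s, hs, f, rfl | hf, rfl⟩
        · exact Or.inr ⟨s, hs, rfl⟩
        · exact Or.inl ⟨s, hs, f, hf, rfl⟩
      · rintro (⟨s, hs, f, hf, rfl⟩ | ⟨s, hs, rfl⟩)
        · exact ⟨s, hs, f, Or.inr hf, rfl⟩
        · exact ⟨s, hs, r, Or.inl rfl, rfl⟩
    have hcap : Finset.image₂ (· + ·) (S M) F ∩ (S M).image (· + r) ⊆
        F.biUnion fun f => ((S M).filter fun n => n + (r - f) ∈ E).image (· + r) := by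
      intro n hn
      simp only [Finset.mem_inter, Finset.mem_image₂, Finset.mem_image] at hn
      obtain ⟨⟨s, hs, f, hf, hsf⟩, s', hs', rfl⟩ := hn
      simp only [Finset.mem_biUnion, Finset.mem_image, Finset.mem_filter]
      refine ⟨f, hf, s', ⟨hs', ?_⟩, rfl⟩
      have := hle f hf
      have h4 : s' + (r - f) = s := by omega
      rw [h4]
      exact hSE M s hs
    have hcard : ((Finset.image₂ (· + ·) (S M) F ∩ (S M).image (· + r)).card : ℝ)
        ≤ q * (η * M) := by
      calc ((Finset.image₂ (· + ·) (S M) F ∩ (S M).image (· + r)).card : ℝ)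
          ≤ ((F.biUnion fun f => ((S M).filter fun n => n + (r - f) ∈ E).image (· + r)).card : ℝ) := by
            exact_mod_cast Finset.card_le_card hcap
        _ ≤ ∑ f ∈ F, (shiftCount E (S M) (r - f) : ℝ) := by
            refine (Nat.cast_le.2 (Finset.card_biUnion_le.trans
              (Finset.sum_le_sum fun f _ => Finset.card_image_le))).trans ?_
            push_cast
            exact le_rfl
        _ ≤ ∑ f ∈ F, η * M := Finset.sum_le_sum h2
        _ = F.card * (η * M) := by rw [Finset.sum_const, nsmul_eq_mul]
        _ ≤ q * (η * M) :=
            mul_le_mul_of_nonneg_right (by exact_mod_cast hF) (by positivity)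
    have hinj : ((S M).image (· + r)).card = (S M).card :=
      Finset.card_image_of_injective _ (add_left_injective r)
    have hun : ((Finset.image₂ (· + ·) (S M) F ∪ (S M).image (· + r)).card : ℝ)
        + (Finset.image₂ (· + ·) (S M) F ∩ (S M).image (· + r)).card
        = (Finset.image₂ (· + ·) (S M) F).card + (S M).card := by
      rw [← hinj]
      exact_mod_cast Finset.card_union_add_card_inter _ _
    rw [himg]
    have hM : 0 ≤ η * M := by positivity
    push_cast
    nlinarith

/-- Each `α a` is at most `max K 1 ^ g` times a value at a point of `D` in `[a, a + g]`, and each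
point of `D` serves at most `g + 1` values of `a`. -/
theorem tsum_ne_top_of_syndetic {α : ℕ → ℝ≥0∞} {K : ℝ≥0∞} (hK : K ≠ ∞)
    (hα : ∀ i, α i ≤ K * α (i + 1)) {D : Set ℕ} {g : ℕ}
    (hD : ∀ a, ∃ r ∈ D, a ≤ r ∧ r ≤ a + g) (hsum : ∑' i, D.indicator α i ≠ ∞) :
    ∑' i, α i ≠ ∞ := by
  have hstep : ∀ n i, α i ≤ (max K 1) ^ n * α (i + n) := by
    intro n
    induction n with
    | zero => simp
    | succ n ih =>
      intro i
      calc α i ≤ (max K 1) ^ n * α (i + n) := ih i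
        _ ≤ (max K 1) ^ n * (max K 1 * α (i + n + 1)) := by
            gcongr
            exact (hα _).trans (by gcongr; exact le_max_left _ _)
        _ = (max K 1) ^ (n + 1) * α (i + (n + 1)) := by rw [pow_succ, mul_assoc]; rfl
  have hpt : ∀ a, α a ≤ (max K 1) ^ g * ∑ i ∈ Finset.range (g + 1), D.indicator α (a + i) := by
    intro a
    obtain ⟨r, hr, h1, h2⟩ := hD a
    obtain ⟨i, rfl⟩ := Nat.exists_eq_add_of_le h1
    calc α a ≤ (max K 1) ^ i * α (a + i) := hstep i a
      _ ≤ (max K 1) ^ g * D.indicator α (a + i) := by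
          rw [indicator_of_mem hr]
          gcongr
          · exact le_max_right _ _
          · omega
      _ ≤ _ := by
          gcongr
          exact Finset.single_le_sum (f := fun i => D.indicator α (a + i))
            (fun _ _ => zero_le) (Finset.mem_range.2 (by omega))
  refine ne_top_of_le_ne_top ?_ (ENNReal.tsum_le_tsum hpt)
  rw [ENNReal.tsum_mul_left, Summable.tsum_finsetSum (fun _ _ => ENNReal.summable)]
  refine ENNReal.mul_ne_top (ENNReal.pow_ne_top (by simp [hK])) ?_
  refine (ENNReal.sum_lt_top.2 fun i _ => lt_of_le_of_lt ?_ hsum.lt_top).ne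
  exact ENNReal.tsum_comp_le_tsum_of_injective (add_left_injective i |>.comp fun _ _ h => h) _

open Classical in
/-- The theorem of Bayart and Ruzsa on difference sets, in the form used for weighted shifts. -/
theorem tsum_ne_top_of_tsum_differences_le {E : Set ℕ} (hE : E ∈ familyUBd) {α : ℕ → ℝ≥0∞}
    {K C : ℝ≥0∞} (hK : K ≠ ∞) (hC : C ≠ ∞) (hα : ∀ i, α i ≤ K * α (i + 1))
    (hsum : ∀ n ∈ E, ∑' i, (if n + i ∈ E then α i else 0) ≤ C) : ∑' i, α i ≠ ∞ := by
  obtain ⟨δ, hδ, hf⟩ := mem_familyUBd_iff.1 hE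
  have hne : NeBot (atTop ⊓ 𝓟 {M : ℕ | ∃ k, δ * M ≤ (E ∩ Icc (k + 1) (k + M)).ncard}) :=
    frequently_mem_iff_neBot.1 hf
  -- Along an ultrafilter, a difference that fails to be frequent is eventually rare, with no
  -- passage to subsequences; this one also retains only lengths `M` with a dense window.
  let U : Ultrafilter ℕ :=
    Ultrafilter.of (atTop ⊓ 𝓟 {M : ℕ | ∃ k, δ * M ≤ (E ∩ Icc (k + 1) (k + M)).ncard})
  have hU : (U : Filter ℕ) ≤ atTop ⊓ 𝓟 _ := Ultrafilter.of_le _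
  have hUtop : (U : Filter ℕ) ≤ atTop := hU.trans inf_le_left
  have hUm : ∀ᶠ M : ℕ in U, ∃ k, δ * M ≤ (E ∩ Icc (k + 1) (k + M)).ncard :=
    (hU.trans inf_le_right) (mem_principal_self _)
  obtain ⟨k, hk⟩ : ∃ k : ℕ → ℕ, ∀ᶠ M : ℕ in U,
      δ * M ≤ (E ∩ Icc (k M + 1) (k M + M)).ncard := by
    choose! k hk using fun (M : ℕ)
      (h : ∃ k, δ * M ≤ ((E ∩ Icc (k + 1) (k + M)).ncard : ℝ)) => h
    exact ⟨k, hUm.mono hk⟩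
  let S : ℕ → Finset ℕ := fun M => (Finset.Icc (k M + 1) (k M + M)).filter (· ∈ E)
  have hScard : ∀ M, (E ∩ Icc (k M + 1) (k M + M)).ncard = (S M).card := fun M => by
    rw [← ncard_coe_finset]
    congr 1
    ext n
    simp [S, and_comm]
  have hSM : ∀ M, (S M).card ≤ M := fun M => hScard M ▸ ncard_inter_Icc_le _ _ _
  have hSE : ∀ M, ∀ n ∈ S M, n ∈ E := fun M n hn => (Finset.mem_filter.1 hn).2
  have hS : ∀ᶠ M : ℕ in U, δ * M ≤ (S M).card := hk.mono fun M hM => by rwa [← hScard]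
  -- With `q δ ≥ 3` and `q ^ 2 η = 1`, the `q` translates cover at least `2 M` points, yet they lie
  -- in an interval of `M + F.sup id < 2 M` integers.
  obtain ⟨q, hq⟩ := exists_nat_ge (3 / δ)
  rw [div_le_iff₀ hδ] at hq
  have hq0 : (0 : ℝ) < q := by
    by_contra! h
    nlinarith
  set η : ℝ := 1 / q ^ 2 with hη
  have hη0 : 0 < η := by positivity
  let D : Set ℕ := {r | ∀ᶠ M : ℕ in U, η * M < shiftCount E (S M) r}
  have hgap : ∃ g : ℕ, ∀ a, ∃ r ∈ D, a ≤ r ∧ r ≤ a + g := by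
    by_contra! hcon
    obtain ⟨F, hF, h⟩ := exists_translates (U : Filter ℕ) S hSE hS hη0.le (fun g => by
      obtain ⟨a, ha⟩ := hcon g
      refine ⟨a, fun r h1 h2 => ?_⟩
      have : r ∉ D := fun hr => absurd (ha r hr h1) (by omega)
      exact (Ultrafilter.eventually_not.2 this).mono fun M hM => not_lt.1 hM) q
    obtain ⟨M, h1, h2⟩ := (h.and (hUtop (eventually_gt_atTop (F.sup id)))).exists
    have h3 : (Finset.image₂ (· + ·) (S M) F).card ≤ M + F.sup id := by
      calc (Finset.image₂ (· + ·) (S M) F).card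
          ≤ (Finset.Icc (k M + 1) (k M + M + F.sup id)).card := by
            refine Finset.card_le_card fun n hn => ?_
            obtain ⟨s, hs, f, hf, rfl⟩ := Finset.mem_image₂.1 hn
            have h4 := Finset.mem_Icc.1 (Finset.mem_filter.1 hs).1
            have h5 : f ≤ F.sup id := Finset.le_sup (f := id) hf
            exact Finset.mem_Icc.2 ⟨by omega, by omega⟩
        _ = M + F.sup id := by rw [Nat.card_Icc]; omega
    have h4 : ((Finset.image₂ (· + ·) (S M) F).card : ℝ) ≤ M + (F.sup id : ℕ) := by
      exact_mod_cast h3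
    have h5 : ((F.sup id : ℕ) : ℝ) < M := by exact_mod_cast h2
    have h6 : (q : ℝ) ^ 2 * η = 1 := by rw [hη]; field_simp
    rw [h6] at h1
    nlinarith
  obtain ⟨g, hg⟩ := hgap
  refine tsum_ne_top_of_syndetic hK hα hg ?_
  have hbound : ∀ F : Finset ℕ, ∑ r ∈ F, D.indicator α r ≤ C / ENNReal.ofReal η := by
    intro F
    have hev : ∀ᶠ M : ℕ in U, ∀ r ∈ F, r ∈ D → η * M < shiftCount E (S M) r :=
      (Finset.eventually_all F).2 fun r _ => by
        by_cases hr : r ∈ D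
        · exact Eventually.mono hr fun M hM _ => hM
        · exact Eventually.of_forall fun M h => absurd h hr
    obtain ⟨M, h1, hM⟩ := (hev.and (hUtop (eventually_gt_atTop 0))).exists
    have hM0 : (M : ℝ≥0∞) ≠ 0 := by exact_mod_cast hM.ne'
    rw [ENNReal.le_div_iff_mul_le (Or.inl (by simpa using hη0)) (Or.inl ENNReal.ofReal_ne_top)]
    rw [← ENNReal.mul_le_mul_iff_left hM0 (ENNReal.natCast_ne_top M)]
    -- Double counting: each `r ∈ D` is a difference for more than `η M` points of the window, while
    -- each of the at most `M` points contributes at most `C`.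
    calc (∑ r ∈ F, D.indicator α r) * ENNReal.ofReal η * M
        = ∑ r ∈ F, D.indicator α r * ENNReal.ofReal (η * M) := by
          rw [ENNReal.ofReal_mul hη0.le, ENNReal.ofReal_natCast, mul_assoc, Finset.sum_mul]
      _ ≤ ∑ r ∈ F, α r * shiftCount E (S M) r := by
          refine Finset.sum_le_sum fun r hr => ?_
          by_cases hrD : r ∈ D
          · rw [indicator_of_mem hrD]
            gcongr
            rw [← ENNReal.ofReal_natCast]
            exact ENNReal.ofReal_le_ofReal (h1 r hr hrD).le
          · simp [hrD]
      _ = ∑ n ∈ S M, ∑ r ∈ F, if n + r ∈ E then α r else 0 := by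
          rw [Finset.sum_comm]
          refine Finset.sum_congr rfl fun r _ => ?_
          rw [← Finset.sum_filter, Finset.sum_const, nsmul_eq_mul, mul_comm]
          rfl
      _ ≤ ∑ n ∈ S M, C := Finset.sum_le_sum fun n hn =>
          (ENNReal.sum_le_tsum F).trans (hsum n (hSE M n hn))
      _ = (S M).card * C := by rw [Finset.sum_const, nsmul_eq_mul]
      _ ≤ C * M := by
          rw [mul_comm]
          gcongr
          exact hSM M
  refine ne_top_of_le_ne_top (ENNReal.div_ne_top hC (ENNReal.ofReal_pos.2 hη0).ne') ?_
  rw [ENNReal.tsum_eq_iSup_sum]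
  exact iSup_le hbound

/-! ### Thinning and separating sets of positive density -/

theorem ncard_inter_Icc_add (A : Set ℕ) (a M : ℕ) :
    (A ∩ Icc 1 (a + M)).ncard = (A ∩ Icc 1 a).ncard + (A ∩ Icc (a + 1) (a + M)).ncard := by
  rw [← ncard_union_eq _ ((finite_Icc _ _).inter_of_right _) ((finite_Icc _ _).inter_of_right _)]
  · congr 1
    ext n
    simp only [mem_inter_iff, mem_Icc, mem_union]
    constructor
    · rintro ⟨h1, h2, h3⟩
      by_cases h : n ≤ a
      · exact Or.inl ⟨h1, h2, h⟩
      · exact Or.inr ⟨h1, by omega, h3⟩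
    · rintro (⟨h1, h2, h3⟩ | ⟨h1, h2, h3⟩)
      · exact ⟨h1, h2, by omega⟩
      · exact ⟨h1, by omega, h3⟩
  · rw [Set.disjoint_left]
    rintro n ⟨_, h1⟩ ⟨_, h2⟩
    have := h1.2
    have := h2.1
    omega

theorem ncard_inter_Icc_succ_of_mem {A : Set ℕ} {M : ℕ} (h : M + 1 ∈ A) :
    (A ∩ Icc 1 (M + 1)).ncard = (A ∩ Icc 1 M).ncard + 1 := by
  rw [ncard_inter_Icc_add A M 1, Icc_self, inter_eq_right.2 (singleton_subset_iff.2 h), ncard_singleton]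

theorem ncard_inter_Icc_succ_of_notMem {A : Set ℕ} {M : ℕ} (h : M + 1 ∉ A) :
    (A ∩ Icc 1 (M + 1)).ncard = (A ∩ Icc 1 M).ncard := by
  rw [ncard_inter_Icc_add A M 1, Icc_self, inter_singleton_eq_empty.2 h, ncard_empty, add_zero]

/-- Every `q`-th element of `A`. -/
def thin (q : ℕ) (A : Set ℕ) : Set ℕ := {a | a ∈ A ∧ 1 ≤ a ∧ q ∣ (A ∩ Icc 1 (a - 1)).ncard}

theorem thin_subset (q : ℕ) (A : Set ℕ) : thin q A ⊆ A := fun _ h => h.1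

theorem thin_count {q : ℕ} (hq : 0 < q) (A : Set ℕ) (M : ℕ) :
    (A ∩ Icc 1 M).ncard ≤ q * (thin q A ∩ Icc 1 M).ncard ∧
      q * (thin q A ∩ Icc 1 M).ncard < (A ∩ Icc 1 M).ncard + q := by
  induction M with
  | zero => simpa using hq
  | succ M ih =>
    by_cases hA : M + 1 ∈ A
    · rw [ncard_inter_Icc_succ_of_mem hA]
      by_cases hd : q ∣ (A ∩ Icc 1 M).ncard
      · rw [ncard_inter_Icc_succ_of_mem (show M + 1 ∈ thin q A from ⟨hA, by omega, hd⟩)]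
        obtain ⟨c, hc⟩ := hd
        rw [hc] at ih ⊢
        have h1 : c ≤ (thin q A ∩ Icc 1 M).ncard := le_of_mul_le_mul_left ih.1 hq
        have h2 : (thin q A ∩ Icc 1 M).ncard < c + 1 := by
          refine lt_of_mul_lt_mul_left (a := q) ?_ (Nat.zero_le _)
          rw [mul_add, mul_one]
          exact ih.2
        have h3 : (thin q A ∩ Icc 1 M).ncard = c := by omega
        rw [h3, mul_add, mul_one]
        omega
      · rw [ncard_inter_Icc_succ_of_notMem (fun h : M + 1 ∈ thin q A => hd h.2.2)]
        have : (A ∩ Icc 1 M).ncard ≠ q * (thin q A ∩ Icc 1 M).ncard := fun h => hd ⟨_, h⟩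
        omega
    · rw [ncard_inter_Icc_succ_of_notMem hA,
        ncard_inter_Icc_succ_of_notMem (fun h => hA (thin_subset q A h))]
      exact ih

theorem thin_separated {q : ℕ} {A : Set ℕ} {a b : ℕ} (ha : a ∈ thin q A) (hb : b ∈ thin q A)
    (hab : a < b) : a + q ≤ b := by
  obtain ⟨hA, h1, u, hu⟩ := ha
  obtain ⟨-, -, v, hv⟩ := hb
  have e1 : (A ∩ Icc 1 a).ncard = (A ∩ Icc 1 (a - 1)).ncard + 1 := by
    obtain ⟨c, rfl⟩ := Nat.exists_eq_add_of_le' h1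
    exact ncard_inter_Icc_succ_of_mem hA
  have e2 := ncard_inter_Icc_add A a (b - 1 - a)
  rw [show a + (b - 1 - a) = b - 1 by omega] at e2
  have e3 := ncard_inter_Icc_le A a (b - 1 - a)
  rw [show a + (b - 1 - a) = b - 1 by omega] at e3
  have huv : u < v := lt_of_mul_lt_mul_left (a := q) (by omega) (Nat.zero_le _)
  have : q * (u + 1) ≤ q * v := Nat.mul_le_mul_left q huv
  rw [mul_add, mul_one] at this
  omega

theorem ncard_inter_Icc_le_inter_Ioi_add (A : Set ℕ) (X a b : ℕ) :
    (A ∩ Icc (a + 1) b).ncard ≤ ((A ∩ Ioi X) ∩ Icc (a + 1) b).ncard + X := by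
  calc (A ∩ Icc (a + 1) b).ncard ≤ (((A ∩ Ioi X) ∩ Icc (a + 1) b) ∪ Icc 1 X).ncard := by
        refine ncard_le_ncard (fun n hn => ?_)
          (((finite_Icc _ _).inter_of_right _).union (finite_Icc _ _))
        by_cases h : X < n
        · exact Or.inl ⟨⟨hn.1, h⟩, hn.2⟩
        · exact Or.inr ⟨by have := hn.2.1; omega, not_lt.1 h⟩
    _ ≤ _ := ncard_union_le _ _
    _ = ((A ∩ Ioi X) ∩ Icc (a + 1) b).ncard + X := by
        rw [← Finset.coe_Icc 1 X, ncard_coe_finset (Finset.Icc 1 X), Nat.card_Icc]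
        omega

/-- The points at distance at most `g` from `A`. -/
def thickening (g : ℕ) (A : Set ℕ) : Set ℕ := {m | ∃ n ∈ A, m ≤ n + g ∧ n ≤ m + g}

/-- Each point thickens to at most `2 g + 1` points. A point `0` would thicken into `Icc 1 M`
without being counted on the right, hence `h0`. -/
theorem ncard_thickening_le (g : ℕ) {A : Set ℕ} (h0 : 0 ∉ A) (M : ℕ) :
    (thickening g A ∩ Icc 1 M).ncard ≤ (A ∩ Icc 1 (M + g)).ncard * (2 * g + 1) := by
  classical
  have hfin : (A ∩ Icc 1 (M + g)).Finite := (finite_Icc _ _).inter_of_right _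
  calc (thickening g A ∩ Icc 1 M).ncard
      ≤ (⋃ n ∈ hfin.toFinset, Icc (n - g) (n + g)).ncard := by
        refine ncard_le_ncard ?_ (hfin.toFinset.finite_toSet.biUnion fun n _ => finite_Icc _ _)
        rintro m ⟨⟨n, hn, h1, h2⟩, h3, h4⟩
        refine mem_biUnion (x := n) ?_ ⟨by omega, h1⟩
        simp only [Finite.coe_toFinset]
        refine ⟨hn, ?_, by omega⟩
        by_contra h
        exact h0 (by rwa [show n = 0 by omega] at hn)
    _ ≤ ∑ n ∈ hfin.toFinset, (Icc (n - g) (n + g)).ncard := Finset.set_ncard_biUnion_le _ _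
    _ ≤ ∑ n ∈ hfin.toFinset, (2 * g + 1) := by
        refine Finset.sum_le_sum fun n _ => ?_
        rw [← Finset.coe_Icc, ncard_coe_finset, Nat.card_Icc]
        omega
    _ = (A ∩ Icc 1 (M + g)).ncard * (2 * g + 1) := by
        rw [Finset.sum_const, smul_eq_mul, ncard_eq_toFinset_card _ hfin]

/-- Keep every `q k`-th element of `A k` and delete from level `l` the `g k`-neighbourhoods of all
levels `k > l`. As `q` grows fast, the deletions cost at most half of the density that thinning is
sure to leave. The last clause compares counts at the same `M`, so it serves both upper density
(frequently) and lower density (eventually). -/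
theorem exists_separated_of_initial_density (A : ℕ → Set ℕ) (δ : ℕ → ℝ) (hδ : ∀ k, 0 < δ k)
    (g : ℕ → ℕ) :
    ∃ B : ℕ → Set ℕ, (∀ k, B k ⊆ A k) ∧ (∀ k, ∀ n ∈ B k, g k < n) ∧
      (∀ k l, l ≤ k → ∀ n ∈ B k, ∀ m ∈ B l, (k, n) ≠ (l, m) → n + g k < m ∨ m + g k < n) ∧
      ∀ k, ∃ δ' : ℝ, 0 < δ' ∧ ∀ᶠ M : ℕ in atTop,
        δ k * M ≤ (A k ∩ Icc 1 M).ncard → δ' * M ≤ (B k ∩ Icc 1 M).ncard := by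
  have hcpos : ∀ k l : ℕ, 0 < 32 * 2 ^ k * (2 * g k + 1 : ℝ) / δ l := fun k l =>
    div_pos (by positivity) (hδ l)
  -- The constant 32 is 4 · 8: the bound `4 M` on `q k` times the count of `C k` up to `M + g k`,
  -- and the share `δ l / (8 * q l)` allotted to level `k`, weighted by `2 ^ (-k)`.
  let G : ℕ → ℕ := fun k =>
    ⌈∑ l ∈ Finset.range (k + 1), 32 * 2 ^ k * (2 * g k + 1 : ℝ) / δ l⌉₊ + g k + 1
  let q : ℕ → ℕ := fun k => ∏ i ∈ Finset.range (k + 1), G i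
  have hG1 : ∀ k, 1 ≤ G k := fun k => Nat.le_add_left _ _
  have hGg : ∀ k, g k + 1 ≤ G k := fun k => by simp only [G]; omega
  have hGδ : ∀ k l, l ≤ k → 32 * 2 ^ k * (2 * g k + 1 : ℝ) / δ l ≤ G k := by
    intro k l hl
    refine (Finset.single_le_sum (f := fun l => 32 * 2 ^ k * (2 * g k + 1 : ℝ) / δ l)
      (fun i _ => (hcpos k i).le) (Finset.mem_range.2 (Nat.lt_succ_of_le hl))).trans ?_
    refine (Nat.le_ceil _).trans ?_
    simp only [G]
    push_cast
    have : (0 : ℝ) ≤ g k := Nat.cast_nonneg _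
    linarith
  have hq1 : ∀ k, 1 ≤ q k := fun k => Finset.one_le_prod' fun i _ => hG1 i
  have hqs : ∀ k, q (k + 1) = q k * G (k + 1) := fun k => Finset.prod_range_succ _ _
  have hqmono : Monotone q := monotone_nat_of_le_succ fun k => by
    rw [hqs]
    exact Nat.le_mul_of_pos_right _ (hG1 _)
  have hqG : ∀ k l, l < k → q l * G k ≤ q k := by
    intro k l hl
    obtain ⟨k, rfl⟩ := Nat.exists_eq_succ_of_ne_zero (by omega : k ≠ 0)
    rw [Nat.succ_eq_add_one, hqs]
    exact Nat.mul_le_mul_right _ (hqmono (by omega))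
  have hqg : ∀ k, g k + 1 ≤ q k := fun k => by
    refine (hGg k).trans ?_
    exact Nat.le_of_dvd (hq1 k) (Finset.dvd_prod_of_mem G (Finset.mem_range.2 k.lt_succ_self))
  -- Starting beyond `q k` absorbs the rounding error of thinning, `2 * g k` keeps the thickening
  -- away from `[1, g k]`, and `k` leaves only levels `k < M` to meet `[1, M]`.
  let X : ℕ → ℕ := fun k => q k + 2 * g k + k
  let C : ℕ → Set ℕ := fun k => thin (q k) (A k ∩ Ioi (X k))
  have hCX : ∀ k, ∀ n ∈ C k, X k < n := fun k n hn => (thin_subset _ _ hn).2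
  have hup : ∀ k M, q k * (C k ∩ Icc 1 M).ncard ≤ 2 * M := by
    intro k M
    have h1 := (thin_count (hq1 k) (A k ∩ Ioi (X k)) M).2
    have h2 : ((A k ∩ Ioi (X k)) ∩ Icc 1 M).ncard ≤ M := by
      simpa using ncard_inter_Icc_le (A k ∩ Ioi (X k)) 0 M
    by_cases hM : q k ≤ M
    · change q k * (C k ∩ Icc 1 M).ncard < _ at h1
      omega
    · have : C k ∩ Icc 1 M = ∅ := by
        ext n
        simp only [mem_inter_iff, mem_Icc, mem_empty_iff_false, iff_false]
        rintro ⟨h3, -, h4⟩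
        have := hCX k n h3
        simp only [X] at this
        omega
      rw [this]
      simp
  have hthick : ∀ k l, l < k → ∀ M, ((thickening (g k) (C k) ∩ Icc 1 M).ncard : ℝ)
      ≤ δ l / (8 * q l) * M * (1 / 2) ^ k := by
    intro k l hlk M
    by_cases hM : M ≤ g k
    · have : thickening (g k) (C k) ∩ Icc 1 M = ∅ := by
        ext m
        simp only [mem_inter_iff, mem_Icc, mem_empty_iff_false, iff_false]
        rintro ⟨⟨n, h3, h4, h5⟩, -, h6⟩
        have := hCX k n h3
        simp only [X] at this
        omega
      rw [this, ncard_empty, Nat.cast_zero]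
      have := hδ l
      positivity
    · have h1 := ncard_thickening_le (g k) (A := C k)
        (fun h => by have := hCX k 0 h; omega) M
      have h2 := hup k (M + g k)
      have h3 : (q k : ℝ) * (C k ∩ Icc 1 (M + g k)).ncard ≤ 4 * M := by
        have : q k * (C k ∩ Icc 1 (M + g k)).ncard ≤ 4 * M := by omega
        exact_mod_cast this
      have h4 : ((thickening (g k) (C k) ∩ Icc 1 M).ncard : ℝ)
          ≤ (C k ∩ Icc 1 (M + g k)).ncard * (2 * g k + 1) := by exact_mod_cast h1
      have h5 : (q l : ℝ) * (32 * 2 ^ k * (2 * g k + 1 : ℝ) / δ l) ≤ q k := by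
        calc (q l : ℝ) * (32 * 2 ^ k * (2 * g k + 1 : ℝ) / δ l) ≤ q l * G k := by
              gcongr
              exact hGδ k l hlk.le
          _ ≤ q k := by exact_mod_cast hqG k l hlk
      have hql : (0 : ℝ) < q l := by exact_mod_cast hq1 l
      have h6 : (q l : ℝ) * (32 * 2 ^ k * (2 * g k + 1 : ℝ) / δ l) *
          (C k ∩ Icc 1 (M + g k)).ncard ≤ 4 * M :=
        (mul_le_mul_of_nonneg_right h5 (Nat.cast_nonneg _)).trans h3
      refine h4.trans ?_
      have h7 : δ l / (8 * q l) * M * (1 / 2 : ℝ) ^ k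
          = (4 * M) * (δ l / (32 * q l * 2 ^ k)) := by
        rw [one_div, inv_pow]
        field_simp
        ring
      have hd := hδ l
      calc ((C k ∩ Icc 1 (M + g k)).ncard : ℝ) * (2 * g k + 1)
          = (q l : ℝ) * (32 * 2 ^ k * (2 * g k + 1 : ℝ) / δ l) *
            (C k ∩ Icc 1 (M + g k)).ncard * (δ l / (32 * q l * 2 ^ k)) := by
            field_simp
        _ ≤ (4 * M) * (δ l / (32 * q l * 2 ^ k)) :=
            mul_le_mul_of_nonneg_right h6 (by positivity)
        _ = _ := h7.symm
  refine ⟨fun l => C l \ ⋃ k ∈ Ioi l, thickening (g k) (C k),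
    fun k => sdiff_subset.trans ((thin_subset _ _).trans inter_subset_left), ?_, ?_, ?_⟩
  · intro k n hn
    have := hCX k n hn.1
    simp only [X] at this
    omega
  · intro k l hlk n hn m hm hne
    rcases hlk.lt_or_eq with h | rfl
    · by_contra! hcon
      exact hm.2 (mem_biUnion (show k ∈ Ioi l from h) ⟨n, hn.1, hcon.1, hcon.2⟩)
    · have hnm : n ≠ m := fun h => hne (by rw [h])
      have := hqg l
      rcases hnm.lt_or_gt with h | h
      · have := thin_separated hn.1 hm.1 h
        omega
      · have := thin_separated hm.1 hn.1 h
        omega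
  · intro l
    have hql : (0 : ℝ) < q l := by exact_mod_cast hq1 l
    have hd := hδ l
    refine ⟨δ l / (4 * q l), by positivity, ?_⟩
    filter_upwards [tendsto_natCast_atTop_atTop.eventually
      (eventually_ge_atTop (2 * X l / δ l : ℝ))] with M hM hA
    rw [div_le_iff₀ hd] at hM
    have h1 : (A l ∩ Icc 1 M).ncard ≤ q l * (C l ∩ Icc 1 M).ncard + X l :=
      (ncard_inter_Icc_le_inter_Ioi_add (A l) (X l) 0 M).trans
        (Nat.add_le_add_right (thin_count (hq1 l) _ M).1 _)
    have h2 : ((A l ∩ Icc 1 M).ncard : ℝ) ≤ q l * (C l ∩ Icc 1 M).ncard + X l := by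
      exact_mod_cast h1
    have h3 : δ l / (2 * q l) * M ≤ (C l ∩ Icc 1 M).ncard := by
      have : δ l / (2 * q l) * M = δ l * M / 2 / q l := by field_simp
      rw [this, div_le_iff₀ hql]
      nlinarith
    have hsub : (⋃ k ∈ Ioi l, thickening (g k) (C k)) ∩ Icc 1 M ⊆
        ⋃ k ∈ Finset.Ioo l M, thickening (g k) (C k) ∩ Icc 1 M := by
      rintro m ⟨hm, hmM⟩
      obtain ⟨k, hk, n, hn, h4, h5⟩ := mem_iUnion₂.1 hm
      refine mem_iUnion₂.2 ⟨k, Finset.mem_Ioo.2 ⟨hk, ?_⟩, ⟨n, hn, h4, h5⟩, hmM⟩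
      have h6 := hCX k n hn
      have h7 := hmM.2
      simp only [X] at h6
      omega
    have h4 : (((⋃ k ∈ Ioi l, thickening (g k) (C k)) ∩ Icc 1 M).ncard : ℝ)
        ≤ δ l / (4 * q l) * M := by
      calc (((⋃ k ∈ Ioi l, thickening (g k) (C k)) ∩ Icc 1 M).ncard : ℝ)
          ≤ ((⋃ k ∈ Finset.Ioo l M, thickening (g k) (C k) ∩ Icc 1 M).ncard : ℝ) := by
            exact_mod_cast ncard_le_ncard hsub ((Finset.finite_toSet _).biUnion
              fun k _ => (finite_Icc _ _).inter_of_right _)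
        _ ≤ ∑ k ∈ Finset.Ioo l M, ((thickening (g k) (C k) ∩ Icc 1 M).ncard : ℝ) := by
            exact_mod_cast Finset.set_ncard_biUnion_le _ _
        _ ≤ ∑ k ∈ Finset.Ioo l M, δ l / (8 * q l) * M * (1 / 2) ^ k :=
            Finset.sum_le_sum fun k hk => hthick k l (Finset.mem_Ioo.1 hk).1 M
        _ ≤ ∑ k ∈ Finset.range M, δ l / (8 * q l) * M * (1 / 2) ^ k :=
            Finset.sum_le_sum_of_subset_of_nonneg
              (fun k hk => Finset.mem_range.2 (Finset.mem_Ioo.1 hk).2)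
              fun k _ _ => by positivity
        _ ≤ δ l / (8 * q l) * M * 2 := by
            rw [← Finset.mul_sum]
            gcongr
            exact sum_geometric_two_le M
        _ = _ := by field_simp; ring
    have h5 : ((C l ∩ Icc 1 M).ncard : ℝ) ≤
        ((C l \ ⋃ k ∈ Ioi l, thickening (g k) (C k)) ∩ Icc 1 M).ncard
          + ((⋃ k ∈ Ioi l, thickening (g k) (C k)) ∩ Icc 1 M).ncard := by
      have hun : C l ∩ Icc 1 M ⊆ ((C l \ ⋃ k ∈ Ioi l, thickening (g k) (C k)) ∩ Icc 1 M) ∪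
          ((⋃ k ∈ Ioi l, thickening (g k) (C k)) ∩ Icc 1 M) := fun m hm => by
        by_cases h : m ∈ ⋃ k ∈ Ioi l, thickening (g k) (C k)
        · exact Or.inr ⟨h, hm.2⟩
        · exact Or.inl ⟨⟨hm.1, h⟩, hm.2⟩
      exact_mod_cast (ncard_le_ncard hun (((finite_Icc _ _).inter_of_right _).union
        ((finite_Icc _ _).inter_of_right _))).trans (ncard_union_le _ _)
    have h6 : δ l / (2 * q l) * M = δ l / (4 * q l) * M + δ l / (4 * q l) * M := by
      field_simp
      ring
    linarith

theorem exists_thin_window {A : Set ℕ} {δ : ℝ} (hδ : 0 < δ)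
    (h : ∃ᶠ M : ℕ in atTop, ∃ k, δ * M ≤ (A ∩ Icc (k + 1) (k + M)).ncard) {q : ℕ} (hq : 0 < q)
    (t X : ℕ) :
    ∃ a M, t ≤ M ∧ X ≤ a ∧ δ / (2 * q) * M ≤ (thin q A ∩ Icc (a + 1) (a + M)).ncard := by
  obtain ⟨M, ⟨k, hk⟩, hM, ht⟩ := (h.and_eventually ((tendsto_natCast_atTop_atTop.eventually
    (eventually_ge_atTop (2 * (X + q) / δ : ℝ))).and (eventually_ge_atTop t))).exists
  rw [div_le_iff₀ hδ] at hM
  refine ⟨max k X, M, ht, le_max_right _ _, ?_⟩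
  have hq' : (0 : ℝ) < q := by exact_mod_cast hq
  have h1 : (A ∩ Icc (k + 1) (k + M)).ncard
      ≤ (A ∩ Icc (max k X + 1) (max k X + M)).ncard + X := by
    refine (ncard_inter_Icc_le_inter_Ioi_add A X k (k + M)).trans (Nat.add_le_add_right ?_ _)
    refine ncard_le_ncard (fun n hn => ⟨hn.1.1, ?_, ?_⟩) ((finite_Icc _ _).inter_of_right _)
    · have := hn.2.1
      have : X < n := hn.1.2
      omega
    · have := hn.2.2
      omega
  have h2 := thin_count hq A (max k X + M)
  have h3 := thin_count hq A (max k X)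
  rw [ncard_inter_Icc_add, ncard_inter_Icc_add (thin q A), mul_add] at h2
  have h4 : (A ∩ Icc (k + 1) (k + M)).ncard
      ≤ q * (thin q A ∩ Icc (max k X + 1) (max k X + M)).ncard + (X + q) := by omega
  have h5 : ((A ∩ Icc (k + 1) (k + M)).ncard : ℝ)
      ≤ q * (thin q A ∩ Icc (max k X + 1) (max k X + M)).ncard + (X + q) := by exact_mod_cast h4
  have : δ / (2 * q) * M = δ * M / 2 / q := by field_simp
  rw [this, div_le_iff₀ hq']
  nlinarith

/-- Upper Banach density may be witnessed in windows anywhere, so no deletion is needed: windows for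
all levels are placed one after another with large gaps. Stage `t` serves level `(Nat.unpair t).1`,
so every level is served infinitely often. -/
theorem exists_separated_of_window_density (A : ℕ → Set ℕ) (δ : ℕ → ℝ) (hδ : ∀ k, 0 < δ k)
    (hA : ∀ k, ∃ᶠ M : ℕ in atTop, ∃ a, δ k * M ≤ (A k ∩ Icc (a + 1) (a + M)).ncard)
    (g : ℕ → ℕ) :
    ∃ B : ℕ → Set ℕ, (∀ k, B k ⊆ A k) ∧ (∀ k, ∀ n ∈ B k, g k < n) ∧
      (∀ k l, l ≤ k → ∀ n ∈ B k, ∀ m ∈ B l, (k, n) ≠ (l, m) → n + g k < m ∨ m + g k < n) ∧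
      ∀ k, B k ∈ familyUBd := by
  let G : ℕ → ℕ := fun t => ∑ i ∈ Finset.range (t + 1), g (Nat.unpair i).1
  have hG : ∀ i t, i ≤ t → g (Nat.unpair i).1 ≤ G t := fun i t h =>
    Finset.single_le_sum (f := fun i => g (Nat.unpair i).1) (fun _ _ => Nat.zero_le _)
      (Finset.mem_range.2 (Nat.lt_succ_of_le h))
  let T : ℕ → Set ℕ := fun k => thin (g k + 1) (A k)
  obtain ⟨f, hP, hr⟩ := exists_dependent_seq (α := ℕ × ℕ)
    (fun t z => t ≤ z.2 ∧ G t ≤ z.1 ∧ δ (Nat.unpair t).1 / (2 * (g (Nat.unpair t).1 + 1 : ℕ)) * z.2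
      ≤ (T (Nat.unpair t).1 ∩ Icc (z.1 + 1) (z.1 + z.2)).ncard)
    (fun t z z' => z.1 + z.2 + G t ≤ z'.1) (by
      intro t F
      obtain ⟨a, M, h1, h2, h3⟩ := exists_thin_window (hδ _) (hA (Nat.unpair t).1)
        (Nat.succ_pos (g (Nat.unpair t).1)) t (F.sup (fun z => z.1 + z.2) + G t)
      refine ⟨(a, M), ⟨h1, by simp only; omega, h3⟩, fun z hz => ?_⟩
      have : z.1 + z.2 ≤ F.sup (fun z => z.1 + z.2) := Finset.le_sup (f := fun z => z.1 + z.2) hz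
      simp only
      omega)
  refine ⟨fun k => ⋃ t ∈ {t | (Nat.unpair t).1 = k},
      T k ∩ Icc ((f t).1 + 1) ((f t).1 + (f t).2), ?_, ?_, ?_, ?_⟩
  · intro k n hn
    obtain ⟨t, -, hn, -⟩ := mem_iUnion₂.1 hn
    exact thin_subset _ _ hn
  · intro k n hn
    obtain ⟨t, rfl, -, h1, -⟩ := mem_iUnion₂.1 hn
    have := hG t t le_rfl
    have := (hP t).2.1
    omega
  · intro k l _ n hn m hm hne
    obtain ⟨t, rfl, hn, h1, h2⟩ := mem_iUnion₂.1 hn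
    obtain ⟨t', rfl, hm, h3, h4⟩ := mem_iUnion₂.1 hm
    rcases lt_trichotomy t t' with h | rfl | h
    · have := hr _ _ h
      have := hG t t' h.le
      omega
    · have hnm : n ≠ m := fun h => hne (by rw [h])
      rcases hnm.lt_or_gt with h | h
      · have := thin_separated hn hm h
        omega
      · have := thin_separated hm hn h
        omega
    · have := hr _ _ h
      have := hG t t le_rfl
      omega
  · intro k
    refine mem_familyUBd_iff.2 ⟨δ k / (2 * (g k + 1 : ℕ)),
      div_pos (hδ k) (by positivity), frequently_atTop.2 fun i => ?_⟩
    have h1 := hP (Nat.pair k i)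
    simp only [Nat.unpair_pair] at h1
    refine ⟨(f (Nat.pair k i)).2, (Nat.right_le_pair k i).trans h1.1, (f (Nat.pair k i)).1,
      h1.2.2.trans ?_⟩
    refine Nat.cast_le.2 (ncard_le_ncard (fun n hn => ?_) ((finite_Icc _ _).inter_of_right _))
    exact ⟨mem_iUnion₂.2 ⟨Nat.pair k i, by simp, hn⟩, hn.2⟩

theorem exists_separated_family {𝒜 : Set (Set ℕ)}
    (h𝒜 : 𝒜 = familyUBd ∨ 𝒜 = familyUd ∨ 𝒜 = familyLd) (A : ℕ → Set ℕ) (hA : ∀ k, A k ∈ 𝒜)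
    (g : ℕ → ℕ) :
    ∃ B : ℕ → Set ℕ, (∀ k, B k ⊆ A k) ∧ (∀ k, ∀ n ∈ B k, g k < n) ∧
      (∀ k l, l ≤ k → ∀ n ∈ B k, ∀ m ∈ B l, (k, n) ≠ (l, m) → n + g k < m ∨ m + g k < n) ∧
      ∀ k, B k ∈ 𝒜 := by
  rcases h𝒜 with rfl | rfl | rfl
  · choose δ hδ h using fun k => mem_familyUBd_iff.1 (hA k)
    exact exists_separated_of_window_density A δ hδ h g
  · choose δ hδ h using fun k => mem_familyUd_iff.1 (hA k)
    obtain ⟨B, h1, h2, h3, h4⟩ := exists_separated_of_initial_density A δ hδ g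
    refine ⟨B, h1, h2, h3, fun k => ?_⟩
    obtain ⟨δ', hδ', h5⟩ := h4 k
    exact mem_familyUd_iff.2 ⟨δ', hδ', ((h k).and_eventually h5).mono fun M hM => hM.2 hM.1⟩
  · choose δ hδ h using fun k => mem_familyLd_iff.1 (hA k)
    obtain ⟨B, h1, h2, h3, h4⟩ := exists_separated_of_initial_density A δ hδ g
    refine ⟨B, h1, h2, h3, fun k => ?_⟩
    obtain ⟨δ', hδ', h5⟩ := h4 k
    exact mem_familyLd_iff.2 ⟨δ', hδ', (h5.and (h k)).mono fun M hM => hM.1 hM.2⟩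

/-! ### Weighted shifts in coordinates -/

section Coordinates

variable {𝕜 : Type*} [RCLike 𝕜]

theorem succPNat_add_one (i : ℕ) : Nat.succPNat i + 1 = Nat.succPNat (i + 1) :=
  PNat.eq (by simp [Nat.succPNat_coe])

theorem weightProd_add (w : ℕ+ → 𝕜) (l m n : ℕ) :
    weightProd w l (m + n) = weightProd w l m * weightProd w (l + m) n := by
  unfold weightProd
  rw [Finset.prod_range_add]
  simp only [add_assoc]

theorem weightProd_one (w : ℕ+ → 𝕜) (l : ℕ) : weightProd w l 1 = w (Nat.succPNat l) := by
  simp [weightProd]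

theorem weightProd_zero (w : ℕ+ → 𝕜) (l : ℕ) : weightProd w l 0 = 1 := by
  simp [weightProd]

variable {p : ℝ≥0∞} [Fact (1 ≤ p)]

theorem weightedShift_pow_apply (w : ℕ+ → 𝕜) (hw : BddAbove (range fun n => ‖w n‖)) (n i : ℕ)
    (x : lp (fun _ : ℕ+ => 𝕜) p) :
    (weightedShift p w hw ^ n) x (Nat.succPNat i)
      = weightProd w (i + 1) n * x (Nat.succPNat (i + n)) := by
  induction n generalizing x with
  | zero => simp [weightProd_zero]
  | succ n ih =>
    rw [pow_succ, mul_apply_eq_comp, ih, weightProd_add, weightProd_one]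
    change _ * (w (Nat.succPNat (i + n) + 1) * x (Nat.succPNat (i + n) + 1)) = _
    rw [succPNat_add_one, mul_assoc, show i + n + 1 = i + 1 + n by ring,
      show i + (n + 1) = i + 1 + n by ring]

theorem piMap_pow_apply {N : ℕ} (T : Fin N → lp (fun _ : ℕ+ => 𝕜) p →L[𝕜] lp (fun _ : ℕ+ => 𝕜) p)
    (n : ℕ) (x : Fin N → lp (fun _ : ℕ+ => 𝕜) p) :
    (ContinuousLinearMap.piMap T ^ n) x = fun s => (T s ^ n) (x s) := by
  induction n generalizing x with
  | zero => rfl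
  | succ n ih =>
    rw [pow_succ, mul_apply_eq_comp, ih]
    ext1 s
    rw [pow_succ, mul_apply_eq_comp]
    rfl

theorem tsum_succPNat {α : Type*} [AddCommMonoid α] [TopologicalSpace α] (f : ℕ+ → α) :
    ∑' i, f (Nat.succPNat i) = ∑' n, f n :=
  Equiv.pnatEquivNat.symm.tsum_eq f

theorem enorm_rpow_eq_tsum (hp : p ≠ ∞) (x : lp (fun _ : ℕ+ => 𝕜) p) :
    ‖x‖ₑ ^ p.toReal = ∑' i, ‖x (Nat.succPNat i)‖ₑ ^ p.toReal := by
  have h0 := toReal_pos_of_ne_top p hp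
  rw [tsum_succPNat (fun n => ‖x n‖ₑ ^ p.toReal), ← ofReal_norm,
    ENNReal.ofReal_rpow_of_nonneg (norm_nonneg _) h0.le, lp.norm_rpow_eq_tsum h0,
    ENNReal.ofReal_tsum_of_nonneg (fun n => by positivity) ((lp.memℓp x).summable h0)]
  refine tsum_congr fun n => ?_
  rw [← ofReal_norm (x n), ENNReal.ofReal_rpow_of_nonneg (norm_nonneg _) h0.le]

theorem exists_lp_of_tsum_ne_top (hp : p ≠ ∞) (v : ℕ → 𝕜) (hv : ∑' i, ‖v i‖ₑ ^ p.toReal ≠ ∞) :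
    ∃ x : lp (fun _ : ℕ+ => 𝕜) p, ∀ i, x (Nat.succPNat i) = v i := by
  have h0 := toReal_pos_of_ne_top p hp
  have hmem : Memℓp (fun n : ℕ+ => v n.natPred) p := by
    refine memℓp_gen ?_
    have h1 : ∑' n : ℕ+, ‖v n.natPred‖ₑ ^ p.toReal ≠ ∞ := by
      rw [← tsum_succPNat]
      simpa using hv
    refine (ENNReal.summable_toReal h1).congr fun n => ?_
    rw [← ENNReal.toReal_rpow, toReal_enorm]
  exact ⟨⟨_, hmem⟩, fun i => congrArg v (Nat.natPred_succPNat i)⟩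

theorem norm_coord_le (x : lp (fun _ : ℕ+ => 𝕜) p) (i : ℕ) :
    ‖x (Nat.succPNat i)‖ ≤ ‖x‖ :=
  lp.norm_apply_le_norm (zero_lt_one.trans_le (Fact.out : 1 ≤ p)).ne' x _

/-- The truncation of a sequence to its first `d` terms. -/
def truncate (d : ℕ) (v : ℕ → 𝕜) (i : ℕ) : 𝕜 := if i < d then v i else 0

theorem exists_lp_eq_truncate (hp : p ≠ ∞) (d : ℕ) (v : ℕ → 𝕜) :
    ∃ x : lp (fun _ : ℕ+ => 𝕜) p, ∀ i, x (Nat.succPNat i) = truncate d v i := by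
  refine exists_lp_of_tsum_ne_top hp _ ?_
  have h0 := toReal_pos_of_ne_top p hp
  rw [tsum_eq_sum (s := Finset.range d)]
  · exact (ENNReal.sum_lt_top.2 fun i _ => ENNReal.rpow_lt_top_of_nonneg h0.le enorm_ne_top).ne
  · intro i hi
    rw [truncate, if_neg (by simpa using hi)]
    simp [h0]

/-- Closeness to a vector of `X ^ N` is decided by finitely many coordinates of a nearby finitely
supported vector. -/
theorem exists_approx_by_truncate (hp : p ≠ ∞) {N : ℕ} (u : Fin N → lp (fun _ : ℕ+ => 𝕜) p)
    {r : ℝ} (hr : 0 < r) :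
    ∃ ρ : ℝ, 0 < ρ ∧ ∃ d : ℕ, ∃ O ∈ 𝓝 (fun (s : Fin N) (j : Fin d) => u s (Nat.succPNat j)),
      ∀ b : Fin N → ℕ → 𝕜, (fun (s : Fin N) (j : Fin d) => b s j) ∈ O →
      ∀ z : Fin N → lp (fun _ : ℕ+ => 𝕜) p,
        (∀ s, ∑' i, ‖z s (Nat.succPNat i) - truncate d (b s) i‖ₑ ^ p.toReal ≤ ENNReal.ofReal ρ) →
        ∀ s, dist (z s) (u s) < r := by
  have h0 := toReal_pos_of_ne_top p hp
  -- The vector `u s` is compared with the truncated array at cost `ρ / 2` for the first `d`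
  -- coordinates and `ρ / 2` for the tail; the two distances `r / 4` add up to less than `r`.
  set ρ : ℝ := (r / 4) ^ p.toReal with hρ
  have hρ0 : 0 < ρ := by positivity
  have hρ2 : 0 < ENNReal.ofReal ρ / 2 := ENNReal.half_pos (ENNReal.ofReal_pos.2 hρ0).ne'
  have hroot : ∀ v : lp (fun _ : ℕ+ => 𝕜) p, ‖v‖ₑ ^ p.toReal ≤ ENNReal.ofReal ρ → ‖v‖ ≤ r / 4 := by
    intro v hv
    rw [hρ, ← ENNReal.ofReal_rpow_of_nonneg (by positivity) h0.le,
      ENNReal.rpow_le_rpow_iff h0, ← ofReal_norm] at hv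
    exact (ENNReal.ofReal_le_ofReal_iff (by positivity)).1 hv
  have htail : ∀ᶠ d in atTop, ∀ s,
      ∑' i, ‖u s (Nat.succPNat (i + d))‖ₑ ^ p.toReal < ENNReal.ofReal ρ / 2 := by
    refine eventually_all.2 fun s => ?_
    have h1 : ∑' i, ‖u s (Nat.succPNat i)‖ₑ ^ p.toReal ≠ ∞ := by
      rw [← enorm_rpow_eq_tsum hp]
      exact (ENNReal.rpow_lt_top_of_nonneg h0.le enorm_ne_top).ne
    exact (ENNReal.tendsto_sum_nat_add _ h1).eventually (gt_mem_nhds hρ2)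
  obtain ⟨d, hd⟩ := htail.exists
  refine ⟨ρ, hρ0, d, {b | ∀ s, ∑ j, ‖u s (Nat.succPNat (j : Fin d)) - b s j‖ₑ ^ p.toReal
    < ENNReal.ofReal ρ / 2}, ?_, ?_⟩
  · refine eventually_all.2 fun s => ?_
    have hc : Continuous fun b : Fin N → Fin d → 𝕜 =>
        ∑ j, ‖u s (Nat.succPNat (j : Fin d)) - b s j‖ₑ ^ p.toReal :=
      continuous_finsetSum _ fun j _ =>
        (ENNReal.continuous_rpow_const).comp (continuous_enorm.comp (by fun_prop))
    refine hc.continuousAt.eventually (gt_mem_nhds ?_)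
    simpa [h0] using hρ2
  · intro b hb z hz s
    obtain ⟨y, hy⟩ := exists_lp_eq_truncate (p := p) hp d (b s)
    have h1 : ‖z s - y‖ ≤ r / 4 := by
      refine hroot _ ?_
      rw [enorm_rpow_eq_tsum hp]
      refine le_trans (le_of_eq (tsum_congr fun i => ?_)) (hz s)
      rw [← hy]
      rfl
    have h2 : ‖u s - y‖ ≤ r / 4 := by
      refine hroot _ ?_
      rw [enorm_rpow_eq_tsum hp, ← ENNReal.summable.sum_add_tsum_nat_add' (k := d)]
      have e1 : ∑ i ∈ Finset.range d, ‖(u s - y) (Nat.succPNat i)‖ₑ ^ p.toReal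
          = ∑ j : Fin d, ‖u s (Nat.succPNat j) - b s j‖ₑ ^ p.toReal := by
        rw [Finset.sum_range]
        refine Finset.sum_congr rfl fun j _ => ?_
        change ‖u s (Nat.succPNat j) - y (Nat.succPNat j)‖ₑ ^ p.toReal = _
        rw [hy, truncate, if_pos j.2]
      have e2 : ∑' i, ‖(u s - y) (Nat.succPNat (i + d))‖ₑ ^ p.toReal
          = ∑' i, ‖u s (Nat.succPNat (i + d))‖ₑ ^ p.toReal := by
        refine tsum_congr fun i => ?_
        change ‖u s (Nat.succPNat (i + d)) - y (Nat.succPNat (i + d))‖ₑ ^ p.toReal = _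
        rw [hy, truncate, if_neg (by omega), sub_zero]
      rw [e1, e2, ← ENNReal.add_halves (ENNReal.ofReal ρ)]
      exact add_le_add (hb s).le (hd s).le
    rw [dist_eq_norm]
    calc ‖z s - u s‖ = ‖(z s - y) - (u s - y)‖ := by rw [sub_sub_sub_cancel_right]
      _ ≤ ‖z s - y‖ + ‖u s - y‖ := norm_sub_le _ _
      _ < r := by linarith

variable (𝕜) in
/-- A sequence of finite arrays of nonzero scalars which is recurrently dense. -/
theorem exists_dense_arrays (N : ℕ) :
    ∃ (d : ℕ → ℕ) (b : ℕ → Fin N → ℕ → 𝕜), (∀ L s j, b L s j ≠ 0) ∧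
      ∀ (m : ℕ) (a : Fin N → Fin m → 𝕜), ∀ O ∈ 𝓝 a,
        ∃ᶠ L in atTop, d L = m ∧ (fun (s : Fin N) (j : Fin m) => b L s j) ∈ O := by
  have : Nonempty {z : 𝕜 // z ≠ 0} := ⟨⟨1, one_ne_zero⟩⟩
  let q : ℕ → 𝕜 := fun i => (TopologicalSpace.denseSeq {z : 𝕜 // z ≠ 0} i : 𝕜)
  have hq0 : ∀ i, q i ≠ 0 := fun i => (TopologicalSpace.denseSeq {z : 𝕜 // z ≠ 0} i).2
  have hq : DenseRange q := (dense_compl_singleton (0 : 𝕜)).denseRange_val.comp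
    (TopologicalSpace.denseRange_denseSeq {z : 𝕜 // z ≠ 0}) continuous_subtype_val
  -- The extra factor `ℕ` makes every array occur infinitely often.
  obtain ⟨e, he⟩ := exists_surjective_nat ((Σ m : ℕ, Fin N → Fin m → ℕ) × ℕ)
  let B : (Σ m : ℕ, Fin N → Fin m → ℕ) → Fin N → ℕ → 𝕜 := fun x s j =>
    if h : j < x.1 then q (x.2 s ⟨j, h⟩) else 1
  refine ⟨fun L => (e L).1.1, fun L => B (e L).1, fun L s j => ?_, fun m a O hO => ?_⟩
  · simp only [B]
    split_ifs
    · exact hq0 _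
    · exact one_ne_zero
  · have hdense : DenseRange (Pi.map fun _ : Fin N => Pi.map fun _ : Fin m => q) :=
      DenseRange.piMap fun _ => DenseRange.piMap fun _ => hq
    obtain ⟨f, hf⟩ := hdense.exists_mem_open isOpen_interior ⟨a, mem_interior_iff_mem_nhds.2 hO⟩
    choose g hg using fun r : ℕ => he (⟨m, f⟩, r)
    have hginj : Function.Injective g := fun r r' h => by
      have := (hg r).symm.trans (h ▸ hg r')
      exact (Prod.ext_iff.1 this).2
    refine Nat.frequently_atTop_iff_infinite.2
      (Set.infinite_of_injective_forall_mem hginj fun r => ?_)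
    simp only [mem_ofPred_eq, hg, true_and]
    have hB : (fun (s : Fin N) (j : Fin m) => B ⟨m, f⟩ s j)
        = Pi.map (fun _ : Fin N => Pi.map fun _ : Fin m => q) f := by
      ext s j
      simp [B, Pi.map]
    rw [hB]
    exact interior_subset hf

end Coordinates

/-! ### Construction of a disjoint hypercyclic vector -/

theorem tsum_le_tsum_of_cover {Q : Type*} (φ : Q → ℕ) (f : ℕ → ℝ≥0∞) (G : Q → ℝ≥0∞)
    (h : ∀ i, f i ≠ 0 → ∃ q, φ q = i ∧ f i ≤ G q) : ∑' i, f i ≤ ∑' q, G q := by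
  choose q hq hG using fun i : Function.support f => h i i.2
  calc ∑' i, f i = ∑' i : Function.support f, f i := (tsum_subtype_support f).symm
    _ ≤ ∑' i, G (q i) := ENNReal.tsum_le_tsum hG
    _ ≤ ∑' q, G q := ENNReal.tsum_comp_le_tsum_of_injective (fun i j hij =>
        Subtype.ext ((hq i).symm.trans ((congrArg φ hij).trans (hq j)))) G

/-- The error budget of level `l`. -/
noncomputable def budget (l : ℕ) : ℝ≥0∞ := 2⁻¹ ^ (2 * l + 1)

theorem budget_pos (l : ℕ) : 0 < budget l := ENNReal.pow_pos (by simp) _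

theorem inv_two_pow_anti {m n : ℕ} (h : m ≤ n) : (2⁻¹ : ℝ≥0∞) ^ n ≤ 2⁻¹ ^ m :=
  pow_le_pow_right_of_le_one' (by simp) h

theorem budget_le (k : ℕ) : budget k ≤ 2⁻¹ ^ k := inv_two_pow_anti (by omega)

theorem tsum_budget_max_le (k : ℕ) : ∑' l, budget (max k l) ≤ 2⁻¹ ^ k := by
  calc ∑' l, budget (max k l) ≤ ∑' l, 2⁻¹ ^ k * 2⁻¹ ^ (l + 1) := by
        refine ENNReal.tsum_le_tsum fun l => ?_
        rw [← pow_add]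
        -- Here `2 * max k l + 1 ≥ k + (l + 1)`.
        exact inv_two_pow_anti (by omega)
    _ = 2⁻¹ ^ k := by rw [ENNReal.tsum_mul_left, ENNReal.tsum_geometric_add_one, ENNReal.one_sub_inv_two, inv_inv,
          ENNReal.inv_mul_cancel two_ne_zero ENNReal.ofNat_ne_top, mul_one]

section Construction

variable {𝕜 : Type*} [RCLike 𝕜] {P : ℝ} {N : ℕ}

theorem enorm_mul_div_rpow (hP : 0 < P) (a b : 𝕜) {c : 𝕜} (hc : c ≠ 0) :
    ‖a * (b / c)‖ₑ ^ P = ‖b‖ₑ ^ P * (‖a‖ₑ ^ P / ‖c‖ₑ ^ P) := by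
  rw [enorm_mul, div_eq_mul_inv, enorm_mul, enorm_inv hc, ENNReal.mul_rpow_of_nonneg _ _ hP.le,
    ENNReal.mul_rpow_of_nonneg _ _ hP.le, ENNReal.inv_rpow, div_eq_mul_inv]
  ring

/-- The smallness conditions hold for all large `L`, while (4) gives arbitrarily large `L` with the
right ratios; a strictly increasing choice meets both. -/
theorem exists_levels (hP : 0 < P) {V : Fin N → ℕ → ℕ → 𝕜} {A : ℕ → Set ℕ} {ε : ℕ → ℝ}
    (hε : Tendsto ε atTop (𝓝 0)) (s₀ : Fin N)
    (h4 : ∀ (l : ℕ) (a : Fin N → ℕ → 𝕜), (∀ s j, a s j ≠ 0) → ∀ δ : ℝ, 0 < δ →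
      ∃ L ≥ l, ∀ s t, s ≠ t → ∀ n ∈ A L, ∀ j ≤ l, ‖V s j n / V t j n - a s j / a t j‖ < δ)
    (d : ℕ → ℕ) (b : ℕ → Fin N → ℕ → 𝕜) (hb : ∀ k s j, b k s j ≠ 0) :
    ∃ L : ℕ → ℕ, StrictMono L ∧ ∀ k, d k ≤ L k ∧
      (∀ l ≤ k, (∑ j : Fin (d l), ‖b l s₀ j‖ₑ ^ P) * ENNReal.ofReal (ε (L k)) ≤ budget k) ∧
      ∃ δ : ℝ≥0∞, (∑ j : Fin (d k), ‖b k s₀ j‖ₑ ^ P) * δ ^ P ≤ budget k ∧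
        ∀ s ≠ s₀, ∀ n ∈ A (L k), ∀ j < d k,
          ‖V s j n / V s₀ j n - b k s j / b k s₀ j‖ₑ ≤ δ := by
  have hfin : ∀ l, ∑ j : Fin (d l), ‖b l s₀ j‖ₑ ^ P ≠ ∞ := fun l =>
    (ENNReal.sum_lt_top.2 fun j _ => ENNReal.rpow_lt_top_of_nonneg hP.le enorm_ne_top).ne
  have hδ : ∀ k, ∃ δ : ℝ, 0 < δ ∧
      (∑ j : Fin (d k), ‖b k s₀ j‖ₑ ^ P) * ENNReal.ofReal δ ^ P ≤ budget k := by
    intro k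
    have h1 : Tendsto (fun δ : ℝ => (∑ j : Fin (d k), ‖b k s₀ j‖ₑ ^ P) * ENNReal.ofReal δ ^ P)
        (𝓝[>] 0) (𝓝 ((∑ j : Fin (d k), ‖b k s₀ j‖ₑ ^ P) * ENNReal.ofReal 0 ^ P)) := by
      refine ENNReal.Tendsto.const_mul ?_ (Or.inr (hfin k))
      exact ((ENNReal.continuous_rpow_const.comp ENNReal.continuous_ofReal).tendsto 0).mono_left
        nhdsWithin_le_nhds
    rw [ENNReal.ofReal_zero, ENNReal.zero_rpow_of_pos hP, mul_zero] at h1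
    obtain ⟨δ, h2, h3⟩ := ((h1.eventually (gt_mem_nhds (budget_pos k))).and
      self_mem_nhdsWithin).exists
    exact ⟨δ, h3, h2.le⟩
  choose δ hδ0 hδ using hδ
  obtain ⟨L, hL, h⟩ := extraction_forall_of_frequently (P := fun k L => (d k ≤ L ∧
      ∀ l ≤ k, (∑ j : Fin (d l), ‖b l s₀ j‖ₑ ^ P) * ENNReal.ofReal (ε L) ≤ budget k) ∧
      ∀ s ≠ s₀, ∀ n ∈ A L, ∀ j < d k, ‖V s j n / V s₀ j n - b k s j / b k s₀ j‖ < δ k) (by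
    intro k
    refine Eventually.and_frequently ((eventually_ge_atTop (d k)).and ?_) ?_
    · refine (Set.finite_le_nat k).eventually_all.2 fun l _ => ?_
      have h1 : Tendsto (fun L => (∑ j : Fin (d l), ‖b l s₀ j‖ₑ ^ P) * ENNReal.ofReal (ε L)) atTop
          (𝓝 ((∑ j : Fin (d l), ‖b l s₀ j‖ₑ ^ P) * ENNReal.ofReal 0)) :=
        ENNReal.Tendsto.const_mul (ENNReal.tendsto_ofReal hε) (Or.inr (hfin l))
      rw [ENNReal.ofReal_zero, mul_zero] at h1
      exact (h1.eventually (gt_mem_nhds (budget_pos k))).mono fun L hL => hL.le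
    · refine frequently_atTop.2 fun l => ?_
      obtain ⟨L, h1, h2⟩ := h4 (max l (d k)) (b k) (hb k) (δ k) (hδ0 k)
      exact ⟨L, (le_max_left _ _).trans h1, fun s hs n hn j hj => h2 s s₀ hs n hn j (by omega)⟩)
  refine ⟨L, hL, fun k => ⟨(h k).1.1, (h k).1.2, ENNReal.ofReal (δ k), hδ k,
    fun s hs n hn j hj => ?_⟩⟩
  rw [← ofReal_norm]
  exact ENNReal.ofReal_le_ofReal ((h k).2 s hs n hn j hj).le

/-- Since `V 0 (r + j) = V 0 j * V j r`, each sum over `r` is a tail of a series that converges by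
(1). -/
theorem exists_gaps (hP : 0 < P) {V : ℕ → ℕ → 𝕜}
    (hV : ∀ i m n, V i (m + n) = V i m * V (i + m) n) (hV0 : ∀ i n, V i n ≠ 0)
    (h1 : ∑' n, ‖(V 0 n)⁻¹‖ₑ ^ P ≠ ∞) (d : ℕ → ℕ) (b : ℕ → ℕ → 𝕜) :
    ∃ g : ℕ → ℕ, ∀ k, ∀ l ≤ k, d l ≤ g k ∧
      ∑ j : Fin (d l), ∑' r, ‖b l j / V j (r + g k)‖ₑ ^ P ≤ budget k := by
  suffices h : ∀ k, ∃ g, ∀ l ≤ k, d l ≤ g ∧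
      ∑ j : Fin (d l), ∑' r, ‖b l j / V j (r + g)‖ₑ ^ P ≤ budget k by
    choose g hg using h
    exact ⟨g, hg⟩
  intro k
  refine Eventually.exists (f := atTop) ((Set.finite_le_nat k).eventually_all.2 fun l _ =>
    (eventually_ge_atTop (d l)).and ?_)
  have hlim : Tendsto (fun g => ∑ j : Fin (d l), ∑' r, ‖b l j / V j (r + g)‖ₑ ^ P) atTop
      (𝓝 (∑ _j : Fin (d l), 0)) := by
    refine tendsto_finsetSum _ fun j _ => ?_
    refine ENNReal.tendsto_sum_nat_add (fun r => ‖b l j / V j r‖ₑ ^ P) ?_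
    have hterm : ∀ r, ‖b l j / V j r‖ₑ ^ P
        = ‖b l j * V 0 j‖ₑ ^ P * ‖(V 0 (r + j))⁻¹‖ₑ ^ P := by
      intro r
      rw [← ENNReal.mul_rpow_of_nonneg _ _ hP.le, ← enorm_mul, add_comm r, hV, zero_add]
      have := hV0 0 j
      have := hV0 j r
      congr 2
      field_simp
    simp_rw [hterm]
    rw [ENNReal.tsum_mul_left]
    refine ENNReal.mul_ne_top (ENNReal.rpow_lt_top_of_nonneg hP.le enorm_ne_top).ne ?_
    exact ne_top_of_le_ne_top h1 (ENNReal.tsum_comp_le_tsum_of_injective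
      (add_left_injective (j : ℕ)) fun n => ‖(V 0 n)⁻¹‖ₑ ^ P)
  rw [Finset.sum_const_zero] at hlim
  exact (hlim.eventually (gt_mem_nhds (budget_pos k))).mono fun g hg => hg.le

/-- Blocks of length `d l` placed at the points of well separated sets `B l`. -/
theorem exists_block_sequence {B : ℕ → Set ℕ} {d g : ℕ → ℕ}
    (hsep : ∀ k l, l ≤ k → ∀ n ∈ B k, ∀ m ∈ B l, (k, n) ≠ (l, m) → n + g k < m ∨ m + g k < n)
    (hsep' : ∀ k l, l ≤ k → d l ≤ g k) (c : ℕ → ℕ → ℕ → 𝕜) :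
    ∃ v : ℕ → 𝕜, (∀ l, ∀ j < d l, ∀ m ∈ B l, v (j + m) = c l j m) ∧
      ∀ i, v i ≠ 0 → ∃ l, ∃ j < d l, ∃ m ∈ B l, j + m = i := by
  let ψ : (Σ l, Fin (d l) × B l) → ℕ := fun q => q.2.1 + q.2.2
  have hinj' : ∀ k l, l ≤ k → ∀ (j : Fin (d k)) (n : B k) (j' : Fin (d l)) (m : B l),
      (j + n : ℕ) = j' + m → (⟨k, j, n⟩ : Σ l, Fin (d l) × B l) = ⟨l, j', m⟩ := by
    intro k l hlk j n j' m h
    have h1 := j.2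
    have h2 := j'.2
    have h3 := hsep' k k le_rfl
    have h4 := hsep' k l hlk
    by_cases hne : (k, (n : ℕ)) = (l, (m : ℕ))
    · obtain ⟨rfl, hnm⟩ := Prod.mk.inj hne
      obtain rfl : n = m := Subtype.ext hnm
      obtain rfl : j = j' := Fin.ext (by omega)
      rfl
    · have := hsep k l hlk n n.2 m m.2 hne
      omega
  have hinj : Function.Injective ψ := by
    rintro ⟨k, j, n⟩ ⟨l, j', m⟩ h
    rcases le_total l k with hlk | hlk
    · exact hinj' k l hlk j n j' m h
    · exact (hinj' l k hlk j' m j n h.symm).symm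
  refine ⟨Function.extend ψ (fun q => c q.1 q.2.1 q.2.2) 0, fun l j hj m hm => ?_, fun i hi => ?_⟩
  · exact hinj.extend_apply _ _ (⟨l, ⟨j, hj⟩, ⟨m, hm⟩⟩ : Σ l, Fin (d l) × B l)
  · by_contra hcon
    refine hi (Function.extend_apply' _ _ _ ?_)
    rintro ⟨⟨l, j, m⟩, rfl⟩
    exact hcon ⟨l, j, j.2, m, m.2, rfl⟩

/-- The first sum is the error on the block at `n` itself. By the separation, whatever lies beyond
it comes from blocks at points `m > n`. -/
theorem tsum_block_error_le (hP : 0 < P) {B : ℕ → Set ℕ} {d g : ℕ → ℕ} {V : ℕ → ℕ → 𝕜}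
    {v : ℕ → 𝕜} {c : ℕ → ℕ → ℕ → 𝕜}
    (hv : ∀ l, ∀ j < d l, ∀ m ∈ B l, v (j + m) = c l j m)
    (hv0 : ∀ i, v i ≠ 0 → ∃ l, ∃ j < d l, ∃ m ∈ B l, j + m = i)
    (hsep : ∀ k l, l ≤ k → ∀ n ∈ B k, ∀ m ∈ B l, (k, n) ≠ (l, m) → n + g k < m ∨ m + g k < n)
    (hsep' : ∀ k l, l ≤ k → d l ≤ g k) {k n : ℕ} (hn : n ∈ B k) (y : ℕ → 𝕜) :
    ∑' i, ‖V i n * v (i + n) - truncate (d k) y i‖ₑ ^ P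
      ≤ ∑ j : Fin (d k), ‖V j n * c k j n - y j‖ₑ ^ P
        + ∑' l, ∑ j : Fin (d l), ∑' m : {m // m ∈ B l ∧ n < m},
          ‖V (j + (m - n)) n * c l j m‖ₑ ^ P := by
  rw [← ENNReal.summable.sum_add_tsum_nat_add' (k := d k), Finset.sum_range]
  refine add_le_add (le_of_eq (Finset.sum_congr rfl fun j _ => ?_)) ?_
  · rw [truncate, if_pos j.2, hv k j j.2 n hn]
  · have e : ∑' l, ∑ j : Fin (d l), ∑' m : {m // m ∈ B l ∧ n < m},
          ‖V (j + (m - n)) n * c l j m‖ₑ ^ P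
        = ∑' q : Σ l, Σ _ : Fin (d l), {m // m ∈ B l ∧ n < m},
          ‖V (q.2.1 + (q.2.2 - n)) n * c q.1 q.2.1 q.2.2‖ₑ ^ P := by
      rw [ENNReal.tsum_sigma']
      refine tsum_congr fun l => ?_
      rw [ENNReal.tsum_sigma', tsum_fintype]
    rw [e]
    -- The subtraction is truncated, but it is exact at the `q` that is chosen for each nonzero
    -- term.
    refine tsum_le_tsum_of_cover (fun q => q.2.1 + q.2.2 - n - d k) _ _ fun i hi => ?_
    rw [truncate, if_neg (by omega), sub_zero] at hi ⊢
    have hvi : v (i + d k + n) ≠ 0 := fun h => hi (by simp [h, hP])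
    obtain ⟨l, j, hj, m, hm, hjm⟩ := hv0 _ hvi
    have hnm : n < m := by
      by_cases hne : (k, n) = (l, m)
      · obtain ⟨rfl, rfl⟩ := Prod.mk.inj hne
        omega
      · rcases le_total l k with hlk | hlk
        · have := hsep k l hlk n hn m hm hne
          have := hsep' k l hlk
          omega
        · have := hsep l k hlk m hm n hn (Ne.symm hne)
          have := hsep' l l le_rfl
          omega
    refine ⟨⟨l, ⟨j, hj⟩, ⟨m, hm, hnm⟩⟩, by simp only; omega, ?_⟩
    rw [← hjm, hv l j hj m hm, show i + d k = j + (m - n) by omega]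

theorem exists_sequence_visiting (hP : 0 < P) {V : Fin N → ℕ → ℕ → 𝕜} {s₀ : Fin N}
    (hV : ∀ i m n, V s₀ i (m + n) = V s₀ i m * V s₀ (i + m) n) (hV0 : ∀ i n, V s₀ i n ≠ 0)
    {𝒜 : Set (Set ℕ)} (h𝒜 : 𝒜 = familyUBd ∨ 𝒜 = familyUd ∨ 𝒜 = familyLd)
    {A : ℕ → Set ℕ} (hA : ∀ k, A k ∈ 𝒜) {ε : ℕ → ℝ} (hε : Tendsto ε atTop (𝓝 0))
    (h1 : ∑' n, ‖(V s₀ 0 n)⁻¹‖ₑ ^ P ≠ ∞)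
    (h2 : ∀ l k j, j ≤ l → ∀ n ∈ A k, ∀ s ≠ s₀, ∑' m : {m // m ∈ A l ∧ n < m},
      ‖V s (j + (m - n)) n‖ₑ ^ P / ‖V s₀ j m‖ₑ ^ P ≤ ENNReal.ofReal (ε l))
    (h3 : ∀ k l j, j ≤ k → k < l → ∀ n ∈ A l, ∀ s ≠ s₀, ∑' m : {m // m ∈ A k ∧ n < m},
      ‖V s (j + (m - n)) n‖ₑ ^ P / ‖V s₀ j m‖ₑ ^ P ≤ ENNReal.ofReal (ε l))
    (h4 : ∀ (l : ℕ) (a : Fin N → ℕ → 𝕜), (∀ s j, a s j ≠ 0) → ∀ δ : ℝ, 0 < δ →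
      ∃ L ≥ l, ∀ s t, s ≠ t → ∀ n ∈ A L, ∀ j ≤ l, ‖V s j n / V t j n - a s j / a t j‖ < δ)
    (d : ℕ → ℕ) (b : ℕ → Fin N → ℕ → 𝕜) (hb : ∀ k s j, b k s j ≠ 0) :
    ∃ v : ℕ → 𝕜, ∑' i, ‖v i‖ₑ ^ P ≠ ∞ ∧
      ∀ k, {n | ∀ s, ∑' i, ‖V s i n * v (i + n) - truncate (d k) (b k s) i‖ₑ ^ P
        ≤ 2 * 2⁻¹ ^ k} ∈ 𝒜 := by
  obtain ⟨L, hL, hLk⟩ := exists_levels hP hε s₀ h4 d b hb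
  obtain ⟨g, hg⟩ := exists_gaps hP hV hV0 h1 d (fun l j => b l s₀ j)
  have hsep' : ∀ k l, l ≤ k → d l ≤ g k := fun k l h => (hg k l h).1
  obtain ⟨B, hBA, hBg, hsep, hB⟩ := exists_separated_family h𝒜 (fun k => A (L k))
    (fun k => hA (L k)) g
  obtain ⟨v, hv, hv0⟩ := exists_block_sequence (B := B) hsep hsep'
    (fun l j m => b l s₀ j / V s₀ j m)
  have htail : ∀ l k, l ≤ k → ∀ n, ∑ j : Fin (d l), ∑' m : {m // m ∈ B l ∧ n + g k ≤ m},
      ‖b l s₀ j / V s₀ j (m - n)‖ₑ ^ P ≤ budget k := by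
    intro l k hlk n
    refine le_trans (Finset.sum_le_sum fun j _ => ?_) (hg k l hlk).2
    refine le_trans (le_of_eq (tsum_congr fun m => ?_)) (ENNReal.tsum_comp_le_tsum_of_injective
      (f := fun m : {m // m ∈ B l ∧ n + g k ≤ m} => (m : ℕ) - (n + g k)) (fun m m' h => ?_)
      fun r => ‖b l s₀ j / V s₀ j (r + g k)‖ₑ ^ P)
    · have := m.2.2
      rw [show (m : ℕ) - (n + g k) + g k = m - n by omega]
    · have := m.2.2
      have := m'.2.2
      exact Subtype.ext (by simp only at h; omega)
  refine ⟨v, ?_, fun k => family_mono h𝒜 (hB k) fun n hn s => ?_⟩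
  -- Summability of `v` is the tail estimate at `n = 0`, as every point of `B l` exceeds `g l`.
  · refine ne_top_of_le_ne_top (b := ∑' l, budget (max 0 l))
      (ne_top_of_le_ne_top (by simp) (tsum_budget_max_le 0)) ?_
    calc ∑' i, ‖v i‖ₑ ^ P
        ≤ ∑' q : Σ l, Σ _ : Fin (d l), {m // m ∈ B l ∧ 0 + g l ≤ m},
          ‖b q.1 s₀ q.2.1 / V s₀ q.2.1 (q.2.2 - 0)‖ₑ ^ P := by
          refine tsum_le_tsum_of_cover (fun q => q.2.1 + q.2.2) _ _ fun i hi => ?_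
          obtain ⟨l, j, hj, m, hm, rfl⟩ := hv0 i (fun h => hi (by simp [h, hP]))
          refine ⟨⟨l, ⟨j, hj⟩, ⟨m, hm, by have := hBg l m hm; omega⟩⟩, rfl, ?_⟩
          rw [hv l j hj m hm]
          exact le_rfl
      _ ≤ ∑' l, budget (max 0 l) := by
          rw [ENNReal.tsum_sigma']
          refine ENNReal.tsum_le_tsum fun l => ?_
          rw [ENNReal.tsum_sigma', tsum_fintype, Nat.zero_max]
          exact htail l l le_rfl 0
  · refine (tsum_block_error_le hP hv hv0 hsep hsep' hn (b k s)).trans ?_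
    rw [two_mul]
    refine add_le_add (le_trans ?_ (budget_le k)) (le_trans ?_ (tsum_budget_max_le k))
    · obtain ⟨-, -, δ, hδ, hδ'⟩ := hLk k
      refine le_trans ?_ hδ
      rw [Finset.sum_mul]
      refine Finset.sum_le_sum fun j _ => ?_
      by_cases hs : s = s₀
      · subst hs
        rw [mul_div_cancel₀ _ (hV0 _ _), sub_self]
        simp [hP]
      · have e : V s j n * (b k s₀ j / V s₀ j n) - b k s j
            = b k s₀ j * (V s j n / V s₀ j n - b k s j / b k s₀ j) := by
          have := hb k s₀ j
          have := hV0 j n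
          field_simp
        rw [e, enorm_mul, ENNReal.mul_rpow_of_nonneg _ _ hP.le]
        gcongr
        exact hδ' s hs n (hBA k hn) j j.2
    · refine ENNReal.tsum_le_tsum fun l => ?_
      by_cases hs : s = s₀
      · subst hs
        refine le_trans (Finset.sum_le_sum fun j _ => ?_) (htail l (max k l) (le_max_right _ _) n)
        have hgap : ∀ m : {m // m ∈ B l ∧ n < m}, n + g (max k l) ≤ m := by
          rintro ⟨m, hm, hnm⟩
          have hne : (k, n) ≠ (l, m) := fun h => hnm.ne (Prod.mk.inj h).2
          rcases le_total l k with hlk | hlk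
          · have := hsep k l hlk n hn m hm hne
            rw [max_eq_left hlk]
            simp only
            omega
          · have := hsep l k hlk m hm n hn hne.symm
            rw [max_eq_right hlk]
            simp only
            omega
        refine le_trans (le_of_eq (tsum_congr fun m => ?_))
          (ENNReal.tsum_comp_le_tsum_of_injective
          (f := fun m : {m // m ∈ B l ∧ n < m} =>
            (⟨m, m.2.1, hgap m⟩ : {m // m ∈ B l ∧ n + g (max k l) ≤ m}))
          (fun m m' h => by simpa [Subtype.ext_iff] using h)
          fun m => ‖b l s j / V s j (m - n)‖ₑ ^ P)
        have hm := m.2.2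
        -- For `s₀` the product cancels and leaves `b / V j (m - n)`, a term of the tail controlled
        -- by the gap.
        have e : V s j m = V s j (m - n) * V s (j + (m - n)) n := by
          rw [← hV, Nat.sub_add_cancel hm.le]
        have := hV0 j (m - n)
        have := hV0 (j + (m - n)) n
        rw [e]
        congr 2
        field_simp
      · refine le_trans ?_ ((hLk (max k l)).2.1 l (le_max_right _ _))
        rw [Finset.sum_mul]
        refine Finset.sum_le_sum fun j _ => ?_
        simp_rw [enorm_mul_div_rpow hP _ _ (hV0 _ _)]
        rw [ENNReal.tsum_mul_left]
        gcongr
        have hsub : ∑' m : {m // m ∈ B l ∧ n < m}, ‖V s (j + (m - n)) n‖ₑ ^ P / ‖V s₀ j m‖ₑ ^ P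
            ≤ ∑' m : {m // m ∈ A (L l) ∧ n < m},
              ‖V s (j + (m - n)) n‖ₑ ^ P / ‖V s₀ j m‖ₑ ^ P :=
          ENNReal.tsum_comp_le_tsum_of_injective
            (f := fun m : {m // m ∈ B l ∧ n < m} =>
              (⟨m, hBA l m.2.1, m.2.2⟩ : {m // m ∈ A (L l) ∧ n < m}))
            (fun m m' h => by simpa [Subtype.ext_iff] using h)
            fun m => ‖V s (j + (m - n)) n‖ₑ ^ P / ‖V s₀ j m‖ₑ ^ P
        have hjL : (j : ℕ) ≤ L l := by
          have := (hLk l).1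
          omega
        -- Condition (2) is small when the disturbing block has the higher level, condition (3) when
        -- the visited one has; in both cases the level is `max k l`.
        rcases le_or_gt k l with hkl | hkl
        · rw [max_eq_right hkl]
          exact hsub.trans (h2 _ _ j hjL n (hBA k hn) s hs)
        · rw [max_eq_left hkl.le]
          exact hsub.trans (h3 _ _ j hjL (hL hkl) n (hBA k hn) s hs)

end Construction

/-! ### Sufficiency: from the sets to a disjoint hypercyclic vector -/

section Sufficiency

variable {𝕜 : Type*} [RCLike 𝕜] {p : ℝ≥0∞} [Fact (1 ≤ p)] {N : ℕ}

/-- A vanishing product would contribute `1 / 0 = ∞`; any `W_{i+1,n}` is a factor of `W_{1,i+n}`. -/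
theorem weightProd_ne_zero_of_tsum {w : ℕ+ → 𝕜} {P : ℝ} (hP : 0 < P)
    (h : ∑' n : ℕ+, 1 / ‖weightProd w 1 n‖ₑ ^ P < ∞) (i n : ℕ) : weightProd w (i + 1) n ≠ 0 := by
  have h1 : ∀ n, weightProd w 1 n ≠ 0 := by
    intro n
    rcases Nat.eq_zero_or_pos n with rfl | hn
    · simp [weightProd_zero]
    · intro h0
      have := ENNReal.ne_top_of_tsum_ne_top h.ne ⟨n, hn⟩
      simp [h0, hP] at this
  have := h1 (i + n)
  rw [weightProd_add, add_comm 1 i] at this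
  exact right_ne_zero_of_mul this

theorem tsum_inv_weightProd_ne_top {w : ℕ+ → 𝕜} {P : ℝ} (hP : 0 < P)
    (h : ∑' n : ℕ+, 1 / ‖weightProd w 1 n‖ₑ ^ P < ∞) :
    ∑' n : ℕ, ‖(weightProd w 1 n)⁻¹‖ₑ ^ P ≠ ∞ := by
  have hterm : ∀ n, ‖(weightProd w 1 n)⁻¹‖ₑ ^ P = 1 / ‖weightProd w 1 n‖ₑ ^ P := fun n => by
    rw [enorm_inv (weightProd_ne_zero_of_tsum hP h 0 n), ENNReal.inv_rpow, one_div]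
  rw [← ENNReal.summable.sum_add_tsum_nat_add' (k := 1)]
  refine ENNReal.add_ne_top.2 ⟨by simp [weightProd_zero], ?_⟩
  simp_rw [hterm]
  rw [← tsum_succPNat] at h
  exact h.ne

theorem tendsto_succPNat : Tendsto Nat.succPNat atTop atTop :=
  tendsto_atTop.2 fun b => (eventually_ge_atTop (b : ℕ)).mono fun n hn =>
    PNat.coe_le_coe _ _ |>.1 (by rw [Nat.succPNat_coe]; omega)

theorem tendsto_natPred : Tendsto PNat.natPred atTop atTop :=
  tendsto_atTop.2 fun b => (eventually_ge_atTop (Nat.succPNat b)).mono fun n hn => by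
    have h1 := PNat.coe_le_coe _ _ |>.2 hn
    rw [Nat.succPNat_coe] at h1
    have h2 := n.natPred_add_one
    omega

theorem disjointHypercyclic_of_sets (hp : p ≠ ∞) (hN : 2 ≤ N) (w : Fin N → ℕ+ → 𝕜)
    (hw : ∀ s, BddAbove (range fun n => ‖w s n‖))
    {𝒜 : Set (Set ℕ)} (h𝒜 : 𝒜 = familyUBd ∨ 𝒜 = familyUd ∨ 𝒜 = familyLd)
    {A : ℕ+ → Set ℕ} {ε : ℕ+ → ℝ} (hA : ∀ k, A k ∈ 𝒜) (hε : Tendsto ε atTop (𝓝 0))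
    (h1 : ∀ s, ∑' n : ℕ+, 1 / ‖weightProd (w s) 1 n‖ₑ ^ p.toReal < ∞)
    (h2 : ∀ (l : ℕ+) (j : ℕ), 1 ≤ j → j ≤ l → ∀ k, ∀ n ∈ A k, ∀ s t, s ≠ t →
          ∑' m : {m : ℕ // m ∈ A l ∧ n < m},
            ‖weightProd (w s) (j + m - n) n‖ₑ ^ p.toReal / ‖weightProd (w t) j m‖ₑ ^ p.toReal
              ≤ ENNReal.ofReal (ε l))
    (h3 : ∀ (k l : ℕ+) (j : ℕ), 1 ≤ j → j ≤ k → k < l → ∀ n ∈ A l, ∀ s t, s ≠ t →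
          ∑' m : {m : ℕ // m ∈ A k ∧ n < m},
            ‖weightProd (w s) (j + m - n) n‖ₑ ^ p.toReal / ‖weightProd (w t) j m‖ₑ ^ p.toReal
              ≤ ENNReal.ofReal (ε l))
    (h4 : ∀ (l : ℕ+) (a : Fin N → ℕ → 𝕜), (∀ s, ∀ j ∈ Icc 1 (l : ℕ), a s j ≠ 0) →
          ∀ δ : ℝ, 0 < δ → ∃ L ≥ l, ∀ s t, s ≠ t → ∀ n ∈ A L, ∀ j ∈ Icc 1 (l : ℕ),
            ‖weightProd (w s) j n / weightProd (w t) j n - a s j / a t j‖ < δ) :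
    DisjointHypercyclic 𝒜 (fun s => weightedShift p (w s) (hw s)) := by
  have hP := toReal_pos_of_ne_top p hp
  obtain ⟨d, b, hb, hdense⟩ := exists_dense_arrays 𝕜 N
  let s₀ : Fin N := ⟨0, by omega⟩
  obtain ⟨v, hv, hvis⟩ := exists_sequence_visiting hP
    (V := fun s i n => weightProd (w s) (i + 1) n) (s₀ := s₀)
    (fun i m n => by simp only [weightProd_add, add_right_comm])
    (weightProd_ne_zero_of_tsum hP (h1 s₀)) h𝒜
    (A := fun k => A (Nat.succPNat k)) (fun k => hA _) (ε := fun k => ε (Nat.succPNat k))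
    (hε.comp tendsto_succPNat) (tsum_inv_weightProd_ne_top hP (h1 s₀))
    (fun l k j hj n hn s hs => by
      refine le_trans (le_of_eq (tsum_congr fun m => ?_)) (h2 (Nat.succPNat l) (j + 1)
        (by omega) (by rw [Nat.succPNat_coe]; omega) (Nat.succPNat k) n hn s s₀ hs)
      have := m.2.2
      rw [show j + 1 + (m : ℕ) - n = j + (m - n) + 1 by omega])
    (fun k l j hj hkl n hn s hs => by
      refine le_trans (le_of_eq (tsum_congr fun m => ?_)) (h3 (Nat.succPNat k) (Nat.succPNat l)
        (j + 1) (by omega) (by rw [Nat.succPNat_coe]; omega) (Nat.succPNat_lt_succPNat.2 hkl)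
        n hn s s₀ hs)
      have := m.2.2
      rw [show j + 1 + (m : ℕ) - n = j + (m - n) + 1 by omega])
    (fun l a ha δ hδ => by
      obtain ⟨L, hL, h⟩ := h4 (Nat.succPNat l) (fun s j => a s (j - 1)) (fun s j _ => ha _ _) δ hδ
      refine ⟨L.natPred, ?_, fun s t hst n hn j hj => ?_⟩
      · have h5 := PNat.coe_le_coe _ _ |>.2 hL
        rw [Nat.succPNat_coe] at h5
        have h6 := L.natPred_add_one
        omega
      · simp only [PNat.succPNat_natPred] at hn
        exact h s t hst n hn (j + 1) ⟨by omega, by rw [Nat.succPNat_coe]; omega⟩) d b hb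
  obtain ⟨x, hx⟩ := exists_lp_of_tsum_ne_top hp v hv
  refine ⟨x, fun U hU hUne => ?_⟩
  obtain ⟨u, hu⟩ := hUne
  obtain ⟨r, hr, hrU⟩ := Metric.isOpen_iff.1 hU u hu
  obtain ⟨ρ, hρ, m, O, hO, happ⟩ := exists_approx_by_truncate hp u hr
  have hsmall : ∀ᶠ k in atTop, (2 : ℝ≥0∞) * 2⁻¹ ^ k ≤ ENNReal.ofReal ρ := by
    have h5 : Tendsto (fun k : ℕ => (2 : ℝ≥0∞) * 2⁻¹ ^ k) atTop (𝓝 (2 * 0)) :=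
      ENNReal.Tendsto.const_mul (ENNReal.tendsto_pow_atTop_nhds_zero_of_lt_one
        ENNReal.one_half_lt_one) (Or.inr ENNReal.ofNat_ne_top)
    rw [mul_zero] at h5
    exact (h5.eventually (gt_mem_nhds (ENNReal.ofReal_pos.2 hρ))).mono fun k hk => hk.le
  obtain ⟨k, ⟨rfl, hbO⟩, hk⟩ := ((hdense m _ O hO).and_eventually hsmall).exists
  refine family_mono h𝒜 (hvis k) fun n hn => hrU ?_
  rw [piMap_pow_apply, Metric.mem_ball, dist_pi_lt_iff hr]
  refine happ (b k) hbO _ fun s => le_trans (le_of_eq (tsum_congr fun i => ?_)) ((hn s).trans hk)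
  rw [weightedShift_pow_apply, hx]

end Sufficiency

/-! ### Necessity: from a disjoint hypercyclic vector to the sets -/

section Necessity

variable {𝕜 : Type*} [RCLike 𝕜] {p : ℝ≥0∞} [Fact (1 ≤ p)] {N : ℕ}

theorem return_mem_of_mem_nhds {X : Type*} [AddCommGroup X] [Module 𝕜 X] [TopologicalSpace X]
    {𝒜 : Set (Set ℕ)} (h𝒜 : 𝒜 = familyUBd ∨ 𝒜 = familyUd ∨ 𝒜 = familyLd) {T : X →L[𝕜] X} {x y : X}
    (hx : IsHypercyclicVector 𝒜 T x) {O : Set X} (hO : O ∈ 𝓝 y) : {n | (T ^ n) x ∈ O} ∈ 𝒜 :=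
  family_mono h𝒜 (hx _ isOpen_interior ⟨y, mem_interior_iff_mem_nhds.2 hO⟩)
    fun _ hn => interior_subset (s := O) hn

theorem continuous_coord (i : ℕ+) : Continuous fun x : lp (fun _ : ℕ+ => 𝕜) p => x i := by
  have h0 : p ≠ 0 := (zero_lt_one.trans_le (Fact.out : 1 ≤ p)).ne'
  refine LipschitzWith.continuous (K := 1) (LipschitzWith.of_dist_le_mul fun x y => ?_)
  rw [NNReal.coe_one, one_mul, dist_eq_norm, dist_eq_norm]
  exact lp.norm_apply_le_norm h0 (x - y) i

theorem norm_coord_sub_le (x y : lp (fun _ : ℕ+ => 𝕜) p) (i : ℕ) :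
    ‖x (Nat.succPNat i) - y (Nat.succPNat i)‖ ≤ ‖x - y‖ :=
  norm_coord_le (x - y) i

variable {w : ℕ+ → 𝕜} {hw : BddAbove (range fun n => ‖w n‖)} {x e : lp (fun _ : ℕ+ => 𝕜) p}

/-- At a return time later than `i + n` the first coordinate is within 1 of 2, and it contains the
product as a factor. -/
theorem weightProd_ne_zero_of_returns
    (he : e (Nat.succPNat 0) = 2)
    (hE : {n | ‖(weightedShift p w hw ^ n) x - e‖ < 1} ∈ familyUBd) (i n : ℕ) :
    weightProd w (i + 1) n ≠ 0 := by
  obtain ⟨m, hm, him⟩ := exists_gt_mem_of_mem_familyUBd hE (i + n)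
  have h1 := (norm_coord_sub_le _ e 0).trans_lt hm
  rw [weightedShift_pow_apply, he] at h1
  intro h0
  obtain ⟨r, rfl⟩ := Nat.exists_eq_add_of_lt him
  rw [add_assoc, weightProd_add, weightProd_add, show 0 + 1 + i = i + 1 by ring, h0] at h1
  norm_num at h1

/-- If `n` and `n + i` are both returns, the first coordinate at time `n + i` is `W_{1,i}` times the
coordinate of index `i` at time `n` and has modulus at least 1. Hence the sum of `|W_{1,i}|^{-p}`
over such `i` is at most the `p`-th power of the orbit norm at time `n`. -/
theorem tsum_inv_weightProd_lt_top_of_returns (hp : p ≠ ∞) (he : e (Nat.succPNat 0) = 2)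
    (hE : {n | ‖(weightedShift p w hw ^ n) x - e‖ < 1} ∈ familyUBd) :
    ∑' n : ℕ+, 1 / ‖weightProd w 1 n‖ₑ ^ p.toReal < ∞ := by
  classical
  have hP := toReal_pos_of_ne_top p hp
  have hW := weightProd_ne_zero_of_returns he hE
  have key : ∑' n : ℕ, ‖(weightProd w 1 n)⁻¹‖ₑ ^ p.toReal ≠ ∞ := by
    refine tsum_ne_top_of_tsum_differences_le hE
      (K := ENNReal.ofReal (⨆ m, ‖w m‖) ^ p.toReal)
      (C := ENNReal.ofReal (‖e‖ + 1) ^ p.toReal)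
      (ENNReal.rpow_lt_top_of_nonneg hP.le ENNReal.ofReal_ne_top).ne
      (ENNReal.rpow_lt_top_of_nonneg hP.le ENNReal.ofReal_ne_top).ne (fun i => ?_) fun n hn => ?_
    · have h1 := hW 0 i
      have h2 : w (Nat.succPNat (1 + i)) ≠ 0 := by
        rw [← weightProd_one w, add_comm 1 i]
        exact hW i 1
      have e1 : (weightProd w 1 i)⁻¹ = w (Nat.succPNat (1 + i)) * (weightProd w 1 (i + 1))⁻¹ := by
        rw [weightProd_add, weightProd_one]
        simp only [zero_add] at h1
        field_simp
      rw [e1, enorm_mul, ENNReal.mul_rpow_of_nonneg _ _ hP.le]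
      gcongr
      rw [← ofReal_norm]
      exact ENNReal.ofReal_le_ofReal (norm_weight_le w hw _)
    · have hnorm : ‖(weightedShift p w hw ^ n) x‖ₑ ≤ ENNReal.ofReal (‖e‖ + 1) := by
        rw [← ofReal_norm]
        refine ENNReal.ofReal_le_ofReal ?_
        have h1 := norm_le_norm_add_norm_sub' ((weightedShift p w hw ^ n) x) e
        have h2 : ‖(weightedShift p w hw ^ n) x - e‖ < 1 := hn
        linarith
      refine le_trans ?_ (ENNReal.rpow_le_rpow hnorm hP.le)
      rw [enorm_rpow_eq_tsum hp]
      refine ENNReal.tsum_le_tsum fun i => ?_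
      split_ifs with hi
      · refine ENNReal.rpow_le_rpow ?_ hP.le
        rw [enorm_le_iff_norm_le]
        have h1 := (norm_coord_sub_le _ e 0).trans_lt (show ‖_ - e‖ < 1 from hi)
        rw [weightedShift_pow_apply, he] at h1
        rw [weightedShift_pow_apply]
        have h2 : weightProd w (0 + 1) (n + i) * x (Nat.succPNat (0 + (n + i)))
            = weightProd w 1 i * (weightProd w (i + 1) n * x (Nat.succPNat (i + n))) := by
          rw [zero_add, zero_add, add_comm n i, weightProd_add, mul_assoc, add_comm 1 i]
        rw [h2] at h1
        have h3 : 1 ≤ ‖weightProd w 1 i * (weightProd w (i + 1) n * x (Nat.succPNat (i + n)))‖ := by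
          have h4 := norm_le_norm_add_norm_sub
            (weightProd w 1 i * (weightProd w (i + 1) n * x (Nat.succPNat (i + n)))) (2 : 𝕜)
          have h5 : ‖(2 : 𝕜)‖ = 2 := RCLike.norm_two
          linarith
        rw [norm_mul] at h3
        have h6 : 0 < ‖weightProd w 1 i‖ := norm_pos_iff.2 (hW 0 i)
        rw [norm_inv, inv_le_iff_one_le_mul₀' h6]
        exact h3
      · exact zero_le
  rw [← tsum_succPNat]
  refine lt_of_le_of_lt ?_ key.lt_top
  refine le_trans (le_of_eq (tsum_congr fun n => ?_)) (ENNReal.tsum_comp_le_tsum_of_injective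
    Nat.succ_injective fun n => ‖(weightProd w 1 n)⁻¹‖ₑ ^ p.toReal)
  rw [Nat.succPNat_coe, enorm_inv (hW 0 _), ENNReal.inv_rpow, one_div]

/-- Large target vectors with prescribed ratios of coordinates. -/
theorem exists_target (hp : p ≠ ∞) {V : Fin N → ℕ → 𝕜} (hV : ∀ s i, V s i ≠ 0)
    {b : Fin N → ℕ → 𝕜} (hb : ∀ s j, b s j ≠ 0) (k : ℕ) (R : ℝ) :
    ∃ (c : ℕ → 𝕜) (y : Fin N → lp (fun _ : ℕ+ => 𝕜) p), (∀ j, c j ≠ 0) ∧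
      (∀ s i, y s (Nat.succPNat i) = truncate (k + 1) (fun j => c j * b s j) i) ∧
      (∀ s, ∀ j ≤ k, R ≤ ‖y s (Nat.succPNat j)‖) ∧
      ∀ s i, 1 ≤ i → i ≤ k → ‖y s (Nat.succPNat 0)‖ + 2
        ≤ ‖V s i‖ * (‖y s (Nat.succPNat i)‖ - 1) := by
  have hlim : ∀ s j, Tendsto (fun n : ℕ => (n : ℝ) * ‖b s j‖) atTop atTop := fun s j =>
    tendsto_natCast_atTop_atTop.atTop_mul_const (norm_pos_iff.2 (hb s j))
  have hlarge : ∀ (C : Fin N → ℝ) (j : ℕ), ∃ n : ℕ, n ≠ 0 ∧ ∀ s, C s ≤ n * ‖b s j‖ := fun C j =>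
    ((eventually_ne_atTop 0).and (eventually_all.2 fun s =>
      (hlim s j).eventually_ge_atTop (C s))).exists
  -- The factor of coordinate 0 is fixed first, so that the others can be taken large relative to
  -- it. One factor per coordinate, common to all `s`, preserves the ratios of `b`.
  obtain ⟨n₀, hn₀, h₀⟩ := hlarge (fun _ => R) 0
  choose n hn h using fun j => hlarge (fun s => max R ((n₀ * ‖b s 0‖ + 2) / ‖V s j‖ + 1)) j
  let c : ℕ → 𝕜 := fun j => if j = 0 then (n₀ : 𝕜) else (n j : 𝕜)
  have hc : ∀ j, c j ≠ 0 := fun j => by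
    simp only [c]
    split_ifs
    · exact_mod_cast hn₀
    · exact_mod_cast hn j
  choose y hy using fun s => exists_lp_eq_truncate (p := p) hp (k + 1) (fun j => c j * b s j)
  have hy0 : ∀ s, ‖y s (Nat.succPNat 0)‖ = n₀ * ‖b s 0‖ := fun s => by
    rw [hy, truncate, if_pos (by omega), norm_mul]
    simp [c]
  have hyj : ∀ s j, j ≠ 0 → j ≤ k → ‖y s (Nat.succPNat j)‖ = n j * ‖b s j‖ := fun s j hj hjk => by
    rw [hy, truncate, if_pos (by omega), norm_mul]
    simp [c, hj]
  refine ⟨c, y, hc, hy, fun s j hj => ?_, fun s i hi hik => ?_⟩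
  · by_cases h0 : j = 0
    · rw [h0, hy0]
      exact h₀ s
    · rw [hyj s j h0 hj]
      exact (le_max_left _ _).trans (h j s)
  · rw [hyj s i (by omega) hik, hy0]
    have h1 := (le_max_right _ _).trans (h i s)
    have h2 : 0 < ‖V s i‖ := norm_pos_iff.2 (hV s i)
    have h3 : (n₀ * ‖b s 0‖ + 2) / ‖V s i‖ ≤ n i * ‖b s i‖ - 1 := by linarith
    rw [div_le_iff₀ h2] at h3
    linarith

theorem exists_targets (hp : p ≠ ∞) {V : Fin N → ℕ → 𝕜} (hV : ∀ s i, V s i ≠ 0)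
    {b : ℕ → Fin N → ℕ → 𝕜} (hb : ∀ k s j, b k s j ≠ 0) :
    ∃ (c : ℕ → ℕ → 𝕜) (y : ℕ → Fin N → lp (fun _ : ℕ+ => 𝕜) p), (∀ k j, c k j ≠ 0) ∧
      (∀ k s i, y k s (Nat.succPNat i) = truncate (k + 1) (fun j => c k j * b k s j) i) ∧
      (∀ k s, ∀ j ≤ k, 2 ≤ ‖y k s (Nat.succPNat j)‖) ∧
      (∀ k s i, 1 ≤ i → i ≤ k → ‖y k s (Nat.succPNat 0)‖ + 2
        ≤ ‖V s i‖ * (‖y k s (Nat.succPNat i)‖ - 1)) ∧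
      ∀ l k, l < k → ∀ s t, ∀ j ≤ k,
        (k + 1) * (‖y l t‖ + 1) + 1 ≤ ‖y k s (Nat.succPNat j)‖ := by
  obtain ⟨f, hP, hr⟩ := exists_dependent_seq (α := (ℕ → 𝕜) × (Fin N → lp (fun _ : ℕ+ => 𝕜) p))
    (fun k z => (∀ j, z.1 j ≠ 0) ∧
      (∀ s i, z.2 s (Nat.succPNat i) = truncate (k + 1) (fun j => z.1 j * b k s j) i) ∧
      (∀ s, ∀ j ≤ k, 2 ≤ ‖z.2 s (Nat.succPNat j)‖) ∧
      ∀ s i, 1 ≤ i → i ≤ k → ‖z.2 s (Nat.succPNat 0)‖ + 2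
        ≤ ‖V s i‖ * (‖z.2 s (Nat.succPNat i)‖ - 1))
    (fun k z' z => ∀ s t, ∀ j ≤ k,
      (k + 1) * (‖z'.2 t‖ + 1) + 1 ≤ ‖z.2 s (Nat.succPNat j)‖) (by
    intro k F
    obtain ⟨c, y, h1, h2, h3, h4⟩ := exists_target hp hV (hb k) k
      (2 + ∑ z ∈ F, ∑ t, ((k + 1) * (‖z.2 t‖ + 1) + 1))
    have hnn : ∀ z : (ℕ → 𝕜) × (Fin N → lp (fun _ : ℕ+ => 𝕜) p), ∀ t,
        0 ≤ (k + 1 : ℝ) * (‖z.2 t‖ + 1) + 1 := fun z t => by positivity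
    refine ⟨(c, y), ⟨h1, h2, fun s j hj => le_trans ?_ (h3 s j hj), h4⟩,
      fun z hz s t j hj => le_trans ?_ (h3 s j hj)⟩
    · have : 0 ≤ ∑ z ∈ F, ∑ t, ((k + 1 : ℝ) * (‖z.2 t‖ + 1) + 1) :=
        Finset.sum_nonneg fun z _ => Finset.sum_nonneg fun t _ => hnn z t
      linarith
    · have e1 : (k + 1 : ℝ) * (‖z.2 t‖ + 1) + 1 ≤ ∑ t, ((k + 1 : ℝ) * (‖z.2 t‖ + 1) + 1) :=
        Finset.single_le_sum (f := fun t => (k + 1 : ℝ) * (‖z.2 t‖ + 1) + 1)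
          (fun t _ => hnn z t) (Finset.mem_univ t)
      have e2 := Finset.single_le_sum (f := fun z : (ℕ → 𝕜) × (Fin N → lp (fun _ : ℕ+ => 𝕜) p) =>
        ∑ t, ((k + 1 : ℝ) * (‖z.2 t‖ + 1) + 1))
          (fun z _ => Finset.sum_nonneg fun t _ => hnn z t) hz
      linarith)
  exact ⟨fun k => (f k).1, fun k => (f k).2, fun k => (hP k).1, fun k => (hP k).2.1,
    fun k => (hP k).2.2.1, fun k => (hP k).2.2.2, fun l k h => hr l k h⟩

theorem rpow_div_rpow_le {P : ℝ} (hP : 0 < P) {a b ξ : 𝕜} {c : ℝ} (hc : 0 < c)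
    (h : c ≤ ‖b * ξ‖) : ‖a‖ₑ ^ P / ‖b‖ₑ ^ P ≤ ‖a * ξ‖ₑ ^ P * (ENNReal.ofReal c ^ P)⁻¹ := by
  have hξ : ‖ξ‖ₑ ≠ 0 := by
    intro h0
    rw [enorm_eq_zero.1 h0, mul_zero, norm_zero] at h
    linarith
  rw [← ENNReal.div_rpow_of_nonneg _ _ hP.le, ← div_eq_mul_inv, ← ENNReal.div_rpow_of_nonneg _ _ hP.le]
  refine ENNReal.rpow_le_rpow ?_ hP.le
  rw [← ENNReal.mul_div_mul_right ‖a‖ₑ ‖b‖ₑ hξ enorm_ne_top, ← enorm_mul, ← enorm_mul]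
  refine ENNReal.div_le_div_left ?_ _
  rw [← ofReal_norm (b * ξ)]
  exact ENNReal.ofReal_le_ofReal h

/-- Multiplying both products by `x (j + m)` turns each quotient into a coordinate of `z` over a
number of modulus at least `c`; distinct `m` give distinct coordinates. -/
theorem tsum_ratio_le {P : ℝ} (hP : 0 < P) {V V' : ℕ → ℕ → 𝕜} {x z : ℕ → 𝕜} {c : ℝ} (hc : 0 < c)
    {B : Set ℕ} {n j : ℕ} (hz : ∀ m ∈ B, n < m → z (j + (m - n)) = V (j + (m - n)) n * x (j + m))
    (hB : ∀ m ∈ B, c ≤ ‖V' j m * x (j + m)‖) :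
    ∑' m : {m // m ∈ B ∧ n < m}, ‖V (j + (m - n)) n‖ₑ ^ P / ‖V' j m‖ₑ ^ P
      ≤ (∑' i, ‖z i‖ₑ ^ P) * (ENNReal.ofReal c ^ P)⁻¹ := by
  rw [← ENNReal.tsum_mul_right]
  refine le_trans (ENNReal.tsum_le_tsum fun m => ?_) (ENNReal.tsum_comp_le_tsum_of_injective
    (f := fun m : {m // m ∈ B ∧ n < m} => j + ((m : ℕ) - n)) (fun m m' h => ?_)
    fun i => ‖z i‖ₑ ^ P * (ENNReal.ofReal c ^ P)⁻¹)
  · rw [hz m m.2.1 m.2.2]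
    exact rpow_div_rpow_le hP hc (hB m m.2.1)
  · have := m.2.2
    have := m'.2.2
    exact Subtype.ext (by simp only at h; omega)

theorem ofReal_rpow_le_self {P r : ℝ} (hP : 1 ≤ P) (hr : r ≤ 1) :
    ENNReal.ofReal r ^ P ≤ ENNReal.ofReal r :=
  ENNReal.rpow_le_self_of_le_one (ENNReal.ofReal_le_one.2 hr) hP

/-- The two sum estimates are split by whether the returning target `l` precedes the current one
`k`: the error of approximation to `y k` is used for `l ≤ k`, the size of `y l` for `k < l`. Both
hold also for `s = t`. -/
theorem exists_sets_of_isHypercyclicVector (hp : p ≠ ∞) (hN : 2 ≤ N) {w : Fin N → ℕ+ → 𝕜}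
    {hw : ∀ s, BddAbove (range fun n => ‖w s n‖)}
    {𝒜 : Set (Set ℕ)} (h𝒜 : 𝒜 = familyUBd ∨ 𝒜 = familyUd ∨ 𝒜 = familyLd)
    {x : lp (fun _ : ℕ+ => 𝕜) p} (hV : ∀ s i n, weightProd (w s) (i + 1) n ≠ 0)
    (hx : IsHypercyclicVector 𝒜
      (ContinuousLinearMap.piMap fun s => weightedShift p (w s) (hw s)) (fun _ => x)) :
    ∃ A : ℕ → Set ℕ, (∀ k, A k ∈ 𝒜) ∧ (∀ l k, l < k → Disjoint (A l) (A k)) ∧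
      (∀ l k j, l ≤ k → j ≤ l → ∀ n ∈ A k, ∀ s t, ∑' m : {m // m ∈ A l ∧ n < m},
        ‖weightProd (w s) (j + (m - n) + 1) n‖ₑ ^ p.toReal / ‖weightProd (w t) (j + 1) m‖ₑ ^ p.toReal
          ≤ ENNReal.ofReal (1 / (k + 1))) ∧
      (∀ l k j, k < l → j ≤ l → ∀ n ∈ A k, ∀ s t, ∑' m : {m // m ∈ A l ∧ n < m},
        ‖weightProd (w s) (j + (m - n) + 1) n‖ₑ ^ p.toReal / ‖weightProd (w t) (j + 1) m‖ₑ ^ p.toReal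
          ≤ ENNReal.ofReal (1 / (l + 1))) ∧
      ∀ (l : ℕ) (a : Fin N → ℕ → 𝕜), (∀ s, ∀ j < l, a s j ≠ 0) → ∀ δ : ℝ, 0 < δ →
        ∃ L ≥ l, ∀ s t, ∀ n ∈ A L, ∀ j < l,
          ‖weightProd (w s) (j + 1) n / weightProd (w t) (j + 1) n - a s j / a t j‖ < δ := by
  have hP := toReal_pos_of_ne_top p hp
  have hP1 : 1 ≤ p.toReal := by
    rw [← ENNReal.toReal_one]
    exact ENNReal.toReal_mono hp Fact.out
  obtain ⟨d, b, hb, hdense⟩ := exists_dense_arrays 𝕜 N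
  obtain ⟨c, y, hc, hy, hy2, hyV, hyk⟩ := exists_targets (p := p) hp
    (V := fun s i => weightProd (w s) 1 i) (fun s i => hV s 0 i) hb
  let z : ℕ → Fin N → lp (fun _ : ℕ+ => 𝕜) p := fun n s => (weightedShift p (w s) (hw s) ^ n) x
  have hz : ∀ n s i, z n s (Nat.succPNat i)
      = weightProd (w s) (i + 1) n * x (Nat.succPNat (i + n)) :=
    fun n s i => weightedShift_pow_apply _ _ _ _ _
  let O : ℕ → Set (Fin N → lp (fun _ : ℕ+ => 𝕜) p) := fun k => {u | (∀ s, ‖u s - y k s‖ < 1 / (k + 1)) ∧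
    ∀ s t, ∀ j : Fin (k + 1), ‖u s (Nat.succPNat j) / u t (Nat.succPNat j)
      - y k s (Nat.succPNat j) / y k t (Nat.succPNat j)‖ < 1 / (k + 1)}
  have hy0 : ∀ k s, ∀ j ≤ k, y k s (Nat.succPNat j) ≠ 0 := fun k s j hj => by
    have := hy2 k s j hj
    exact norm_pos_iff.1 (by linarith)
  have hk1 : ∀ k : ℕ, (1 : ℝ) / (k + 1) ≤ 1 := fun k => by
    rw [div_le_one (by positivity)]
    have : (0 : ℝ) ≤ k := Nat.cast_nonneg k
    linarith
  have hO : ∀ k, O k ∈ 𝓝 (y k) := by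
    intro k
    have hk : (0 : ℝ) < 1 / (k + 1) := by positivity
    refine Filter.Eventually.and (eventually_all.2 fun s => ?_) (eventually_all.2 fun s =>
      eventually_all.2 fun t => eventually_all.2 fun j => ?_)
    · have hcont : Continuous fun u : Fin N → lp (fun _ : ℕ+ => 𝕜) p => ‖u s - y k s‖ := by fun_prop
      exact hcont.continuousAt.eventually (gt_mem_nhds (by simpa using hk))
    · have hcs : ∀ s, ContinuousAt (fun u : Fin N → lp (fun _ : ℕ+ => 𝕜) p =>
          u s (Nat.succPNat j)) (y k) := fun s =>
        ((continuous_coord _).comp (continuous_apply s)).continuousAt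
      have hcont := (((hcs s).div (hcs t) (hy0 k t j (by omega))).sub
        (continuousAt_const (y := y k s (Nat.succPNat j) / y k t (Nat.succPNat j)))).norm
      exact hcont.eventually (gt_mem_nhds (by simpa using hk))
  let A : ℕ → Set ℕ := fun k => {n | z n ∈ O k}
  have hA : ∀ k, A k ∈ 𝒜 := fun k => by
    have := return_mem_of_mem_nhds h𝒜 hx (hO k)
    simp_rw [piMap_pow_apply] at this
    exact this
  have hclose : ∀ k, ∀ n ∈ A k, ∀ s, ‖z n s - y k s‖ ≤ 1 := fun k n hn s =>
    (hn.1 s).le.trans (hk1 k)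
  have hlow : ∀ k, ∀ n ∈ A k, ∀ s i, ‖y k s (Nat.succPNat i)‖ - 1 ≤ ‖z n s (Nat.succPNat i)‖ :=
    fun k n hn s i => by
      have h1 := (norm_coord_sub_le (z n s) (y k s) i).trans (hclose k n hn s)
      have h2 := norm_le_norm_add_norm_sub (z n s (Nat.succPNat i)) (y k s (Nat.succPNat i))
      linarith
  have hupp : ∀ k, ∀ n ∈ A k, ∀ s i, ‖z n s (Nat.succPNat i)‖ ≤ ‖y k s (Nat.succPNat i)‖ + 1 :=
    fun k n hn s i => by
      have h1 := (norm_coord_sub_le (z n s) (y k s) i).trans (hclose k n hn s)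
      have h2 := norm_le_norm_add_norm_sub' (z n s (Nat.succPNat i)) (y k s (Nat.succPNat i))
      linarith
  let s₀ : Fin N := ⟨0, by omega⟩
  have hbig : ∀ l k, l < k → ∀ s t, ∀ j ≤ k,
      ‖y l t (Nat.succPNat 0)‖ + 3 ≤ ‖y k s (Nat.succPNat j)‖ := by
    intro l k hlk s t j hj
    have h1 := hyk l k hlk s t j hj
    have h2 := norm_coord_le (y l t) 0
    have h3 := norm_nonneg (y l t)
    have h4 : (1 : ℝ) ≤ k := by exact_mod_cast (by omega : 1 ≤ k)
    nlinarith
  -- A return within `k` steps would make the first coordinate at time `m` a product that the choice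
  -- of `y k` forces above the size of the first coordinate of `y l`.
  have hsep : ∀ l k, l ≤ k → ∀ n ∈ A k, ∀ m ∈ A l, n < m → n + k < m := by
    intro l k hlk n hn m hm hnm
    by_contra! hcon
    obtain ⟨i, rfl⟩ := Nat.exists_eq_add_of_lt hnm
    have h1 := hupp l _ hm s₀ 0
    have h2 : z (n + i + 1) s₀ (Nat.succPNat 0)
        = weightProd (w s₀) 1 (i + 1) * z n s₀ (Nat.succPNat (i + 1)) := by
      rw [hz, hz, show n + i + 1 = (i + 1) + n by ring, zero_add, zero_add, weightProd_add,
        mul_assoc, add_comm 1 (i + 1)]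
    have h3 := hyV k s₀ (i + 1) (by omega) (by omega)
    have h4 := mul_le_mul_of_nonneg_left (hlow k n hn s₀ (i + 1))
      (norm_nonneg (weightProd (w s₀) 1 (i + 1)))
    rw [h2, norm_mul] at h1
    rcases hlk.lt_or_eq with h | rfl
    · have := hbig l k h s₀ s₀ 0 (by omega)
      linarith
    · linarith
  refine ⟨A, hA, fun l k hlk => ?_, ?_, ?_, ?_⟩
  · rw [Set.disjoint_left]
    intro n hn hn'
    have h1 := hupp l n hn s₀ 0
    have h2 := hlow k n hn' s₀ 0
    have h3 := hbig l k hlk s₀ s₀ 0 (by omega)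
    linarith
  · intro l k j hlk hj n hn s t
    refine (tsum_ratio_le hP (V := fun i n => weightProd (w s) (i + 1) n)
      (V' := fun i n => weightProd (w t) (i + 1) n) (x := fun i => x (Nat.succPNat i))
      (z := fun i => (z n s - y k s) (Nat.succPNat i)) one_pos (fun m hm hnm => ?_)
      fun m hm => ?_).trans ?_
    · have h1 := hsep l k hlk n hn m hm hnm
      change z n s (Nat.succPNat _) - y k s (Nat.succPNat _) = _
      rw [hy, truncate, if_neg (by omega), sub_zero, hz,
        show j + (m - n) + n = j + m by omega]
    · rw [← hz]
      have h1 := hlow l m hm t j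
      have h2 := hy2 l t j hj
      linarith
    · rw [← enorm_rpow_eq_tsum hp, ENNReal.ofReal_one, ENNReal.one_rpow, inv_one, mul_one]
      refine le_trans ?_ (ofReal_rpow_le_self hP1 (hk1 k))
      refine ENNReal.rpow_le_rpow ?_ hP.le
      rw [← ofReal_norm]
      exact ENNReal.ofReal_le_ofReal (hn.1 s).le
  · intro l k j hkl hj n hn s t
    -- The orbit has norm at most `‖y k s‖ + 1` at time `n`, so division by this lower bound for the
    -- coordinates at time `m` leaves `1 / (l + 1)`.
    have hc0 : 0 < (l + 1 : ℝ) * (‖y k s‖ + 1) := by positivity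
    refine (tsum_ratio_le hP (V := fun i n => weightProd (w s) (i + 1) n)
      (V' := fun i n => weightProd (w t) (i + 1) n) (x := fun i => x (Nat.succPNat i))
      (z := fun i => z n s (Nat.succPNat i)) hc0 (fun m hm hnm => ?_)
      fun m hm => ?_).trans ?_
    · rw [hz, show j + (m - n) + n = j + m by omega]
    · rw [← hz]
      have h1 := hlow l m hm t j
      have h2 := hyk k l hkl t s j hj
      linarith
    · rw [← enorm_rpow_eq_tsum hp, ← div_eq_mul_inv, ← ENNReal.div_rpow_of_nonneg _ _ hP.le]
      refine le_trans ?_ (ofReal_rpow_le_self hP1 (hk1 l))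
      refine ENNReal.rpow_le_rpow ?_ hP.le
      rw [← ofReal_norm, ← ENNReal.ofReal_div_of_pos hc0]
      refine ENNReal.ofReal_le_ofReal ?_
      rw [div_le_div_iff₀ hc0 (by positivity)]
      have h1 := norm_le_norm_add_norm_sub' (z n s) (y k s)
      have h2 := hclose k n hn s
      have h3 : (0 : ℝ) ≤ l := Nat.cast_nonneg l
      nlinarith
  · intro l a ha δ hδ
    have hO' : {u : Fin N → Fin l → 𝕜 | ∀ s t j, ‖u s j / u t j - a s j / a t j‖ < δ / 2}
        ∈ 𝓝 (fun (s : Fin N) (j : Fin l) => a s j) := by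
      refine eventually_all.2 fun s => eventually_all.2 fun t => eventually_all.2 fun j => ?_
      have hcs : ∀ s, ContinuousAt (fun u : Fin N → Fin l → 𝕜 => u s j)
          (fun (s : Fin N) (j : Fin l) => a s j) := fun s =>
        ((continuous_apply j).comp (continuous_apply s)).continuousAt
      have hcont := (((hcs s).div (hcs t) (ha t j j.2)).sub
        (continuousAt_const (y := a s j / a t j))).norm
      exact hcont.eventually (gt_mem_nhds (by simpa using hδ))
    obtain ⟨L, ⟨-, hL⟩, hLl, hLδ⟩ := ((hdense l _ _ hO').and_eventually
      ((eventually_ge_atTop l).and (tendsto_one_div_add_atTop_nhds_zero_nat.eventually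
        (gt_mem_nhds (half_pos hδ))))).exists
    refine ⟨L, hLl, fun s t n hn j hj => ?_⟩
    have h1 := hn.2 s t ⟨j, by omega⟩
    have h2 := hL s t ⟨j, hj⟩
    have hzt : z n t (Nat.succPNat j) ≠ 0 := by
      have h3 := hlow L n hn t j
      have h4 := hy2 L t j (by omega)
      exact norm_pos_iff.1 (by linarith)
    have hratio : z n s (Nat.succPNat j) / z n t (Nat.succPNat j)
        = weightProd (w s) (j + 1) n / weightProd (w t) (j + 1) n := by
      rw [hz] at hzt
      rw [hz, hz, mul_div_mul_right _ _ (right_ne_zero_of_mul hzt)]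
    have hyratio : y L s (Nat.succPNat j) / y L t (Nat.succPNat j) = b L s j / b L t j := by
      rw [hy, hy, truncate, truncate, if_pos (by omega), if_pos (by omega),
        mul_div_mul_left _ _ (hc L j)]
    simp only at h1 h2
    rw [hratio, hyratio] at h1
    calc ‖weightProd (w s) (j + 1) n / weightProd (w t) (j + 1) n - a s j / a t j‖
        ≤ _ := norm_sub_le_norm_sub_add_norm_sub _ (b L s j / b L t j) _
      _ < δ := by linarith

end Necessity

/-! ### The characterization -/

theorem mainTheorem5 {𝕜 : Type*} [RCLike 𝕜] (p : ℝ≥0∞) [Fact (1 ≤ p)] (hp : p ≠ ∞)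
    (N : ℕ) (hN : 2 ≤ N) (w : Fin N → ℕ+ → 𝕜)
    (hw : ∀ s, BddAbove (range fun n => ‖w s n‖))
    (𝒜 : Set (Set ℕ)) (h𝒜 : 𝒜 = familyUBd ∨ 𝒜 = familyUd ∨ 𝒜 = familyLd) :
    DisjointHypercyclic 𝒜 (fun s => weightedShift p (w s) (hw s)) ↔
      ∃ (A : ℕ+ → Set ℕ) (ε : ℕ+ → ℝ),
        (∀ k, A k ∈ 𝒜) ∧ Pairwise (fun k l => Disjoint (A k) (A l)) ∧
        (∀ k, 0 < ε k) ∧ Tendsto ε atTop (𝓝 0) ∧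
        (∀ s, ∑' n : ℕ+, 1 / ‖weightProd (w s) 1 n‖ₑ ^ p.toReal < ∞) ∧
        (∀ (l : ℕ+) (j : ℕ), 1 ≤ j → j ≤ l → ∀ k, ∀ n ∈ A k, ∀ s t, s ≠ t →
          ∑' m : {m : ℕ // m ∈ A l ∧ n < m},
            ‖weightProd (w s) (j + m - n) n‖ₑ ^ p.toReal / ‖weightProd (w t) j m‖ₑ ^ p.toReal
              ≤ ENNReal.ofReal (ε l)) ∧
        (∀ (k l : ℕ+) (j : ℕ), 1 ≤ j → j ≤ k → k < l → ∀ n ∈ A l, ∀ s t, s ≠ t →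
          ∑' m : {m : ℕ // m ∈ A k ∧ n < m},
            ‖weightProd (w s) (j + m - n) n‖ₑ ^ p.toReal / ‖weightProd (w t) j m‖ₑ ^ p.toReal
              ≤ ENNReal.ofReal (ε l)) ∧
        (∀ (l : ℕ+) (a : Fin N → ℕ → 𝕜), (∀ s, ∀ j ∈ Icc 1 (l : ℕ), a s j ≠ 0) →
          ∀ δ : ℝ, 0 < δ → ∃ L ≥ l, ∀ s t, s ≠ t → ∀ n ∈ A L, ∀ j ∈ Icc 1 (l : ℕ),
            ‖weightProd (w s) j n / weightProd (w t) j n - a s j / a t j‖ < δ) := by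
  constructor
  · rintro ⟨x, hx⟩
    -- The vector `2 e_1`: within distance 1 of it the first coordinate has modulus greater than 1.
    obtain ⟨e, he⟩ := exists_lp_eq_truncate (𝕜 := 𝕜) (p := p) hp 1 (fun _ => 2)
    have he2 : e (Nat.succPNat 0) = 2 := by rw [he, truncate, if_pos one_pos]
    have hE : ∀ s, {n | ‖(weightedShift p (w s) (hw s) ^ n) x - e‖ < 1} ∈ familyUBd := by
      intro s
      have hcont : Continuous fun u : Fin N → lp (fun _ : ℕ+ => 𝕜) p => ‖u s - e‖ := by fun_prop
      have hO : {u : Fin N → lp (fun _ : ℕ+ => 𝕜) p | ‖u s - e‖ < 1} ∈ 𝓝 (fun _ => e) :=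
        hcont.continuousAt.eventually (gt_mem_nhds (by simp))
      have h1 := return_mem_of_mem_nhds h𝒜 hx hO
      simp_rw [piMap_pow_apply] at h1
      exact family_subset_familyUBd h𝒜 h1
    obtain ⟨A, hA, hdisj, hX, hY, h4⟩ := exists_sets_of_isHypercyclicVector hp hN h𝒜
      (fun s => weightProd_ne_zero_of_returns he2 (hE s)) hx
    have hanti : ∀ k l : ℕ, l ≤ k → ENNReal.ofReal (1 / (k + 1)) ≤ ENNReal.ofReal (1 / (l + 1)) :=
      fun k l h => ENNReal.ofReal_le_ofReal (one_div_le_one_div_of_le (by positivity)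
        (by exact_mod_cast Nat.succ_le_succ h))
    have hlt : ∀ {k l : ℕ+}, k < l → k.natPred < l.natPred := fun h => PNat.natPred_lt_natPred.2 h
    refine ⟨fun k => A k.natPred, fun k => 1 / (k.natPred + 1), fun k => hA _, fun k l hkl => ?_,
      fun k => by positivity, tendsto_one_div_add_atTop_nhds_zero_nat.comp tendsto_natPred,
      fun s => tsum_inv_weightProd_lt_top_of_returns hp he2 (hE s), ?_, ?_, ?_⟩
    · rcases hkl.lt_or_gt with h | h
      · exact hdisj _ _ (hlt h)
      · exact (hdisj _ _ (hlt h)).symm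
    · intro l j hj hjl k n hn s t _
      obtain ⟨j, rfl⟩ := Nat.exists_eq_add_of_le' hj
      have hl := l.natPred_add_one
      have hle : ∑' m : {m : ℕ // m ∈ A l.natPred ∧ n < m},
          ‖weightProd (w s) (j + (m - n) + 1) n‖ₑ ^ p.toReal
            / ‖weightProd (w t) (j + 1) m‖ₑ ^ p.toReal
          ≤ ENNReal.ofReal (1 / (l.natPred + 1)) := by
        -- For an earlier or equal target the bound `1 / (k + 1)` is even stronger than required.
        rcases le_or_gt l.natPred k.natPred with h | h
        · exact (hX _ _ j h (by omega) n hn s t).trans (hanti _ _ h)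
        · exact hY _ _ j h (by omega) n hn s t
      refine le_trans (le_of_eq (tsum_congr fun m => ?_)) hle
      have := m.2.2
      rw [show j + 1 + (m : ℕ) - n = j + (m - n) + 1 by omega]
    · intro k l j hj hjk hkl n hn s t _
      obtain ⟨j, rfl⟩ := Nat.exists_eq_add_of_le' hj
      have hk := k.natPred_add_one
      refine le_trans (le_of_eq (tsum_congr fun m => ?_))
        (hX _ _ j (hlt hkl).le (by omega) n hn s t)
      have := m.2.2
      rw [show j + 1 + (m : ℕ) - n = j + (m - n) + 1 by omega]
    · intro l a ha δ hδ
      obtain ⟨L, hL, h⟩ := h4 l (fun s j => a s (j + 1))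
        (fun s j hj => ha s (j + 1) ⟨by omega, hj⟩) δ hδ
      refine ⟨Nat.succPNat L, PNat.coe_le_coe _ _ |>.1 (by rw [Nat.succPNat_coe]; omega),
        fun s t _ n hn j hj => ?_⟩
      simp only [Nat.natPred_succPNat] at hn
      obtain ⟨j, rfl⟩ := Nat.exists_eq_add_of_le' hj.1
      exact h s t n hn j hj.2
  · rintro ⟨A, ε, hA, -, -, hε, h1, h2, h3, h4⟩
    exact disjointHypercyclic_of_sets hp hN w hw h𝒜 hA hε h1 h2 h3 h4
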